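/- \textbf{Theorem (stability condition).} Consider a single-server retrial queue. Incoming calls arrive in a Poisson process of rate $\lambda>0$. An incoming call that finds the server idle starts service at once; otherwise it joins an infinite orbit. Each call in orbit retries independently after exponentially distributed times of rate $\nu>0$, and enters service if it finds the server idle. An idle server makes an outgoing call after an exponentially distributed time of rate $\alpha>0$. Incoming calls ($i=1$) and outgoing calls ($i=2$) have independent positive service times with arbitrary laws of finite means $\mu_{1,1}$ and $\mu_{2,1}$. While it serves a call of type $i$ the server fails at rate $\beta_i\ge 0$; it is then repaired at once, which takes a positive time with an arbitrary law of finite mean $\gamma_{i,1}$, and afterwards the interrupted service resumes with its remaining service time. All these interarrival, retrial, outgoing-call, service, failure and repair times are mutually independent. Let $L_n$ be the number of calls in orbit immediately after the $n$-th service completion (of a call of either type), where $L_0=k\in\{0,1,2,\dots\}$ is arbitrary and the server is idle at time $0$. Then, almost surely, infinitely many services are completed, and $(L_n)_{n\ge 0}$ is a time-homogeneous, irreducible and aperiodic Markov chain on $\{0,1,2,\dots\}$. It is ergodic (that is, irreducible, aperiodic and positive recurrent, in the sense that every state has finite mean return time) if and only if $$\lambda\,\mu_{1,1}\,(1+\beta_1\gamma_{1,1})<1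 .$$ -/

import Mathlib

open MeasureTheory ProbabilityTheory Filter
open scoped ENNReal

namespace RetrialQueue

/-- The two types of calls: incoming (index `1`) and outgoing (index `2`). -/
inductive CallType
  | inbound
  | outbound
  deriving DecidableEq

instance fintypeCallType : Fintype CallType where
  elems := {CallType.inbound, CallType.outbound}
  complete := by intro i; cases i <;> simp

/-- Data of the unreliable `M/G/1` retrial queue with coupled switching. -/
structure Model where
  /-- rate `λ` of the Poisson stream of incoming calls -/
  lam : ℝ
  /-- rate `α` at which an idle server makes an outgoing call -/
  alpha : ℝ
  /-- retrial rate `ν` of each call in orbit -/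
  nu : ℝ
  /-- failure rates `β_1`, `β_2` of the server while it serves a call of the given type -/
  beta : CallType → ℝ
  /-- laws of the service times -/
  service : CallType → ProbabilityMeasure ℝ
  /-- laws of the repair times -/
  repair : CallType → ProbabilityMeasure ℝ

/-- State of the Markov process `K(t)`: server state, number `n` of calls in orbit,
remaining service time `x`, and remaining repair time `y`. -/
inductive State
  /-- server idle (`C = 0`) -/
  | idle (n : ℕ)
  /-- server busy with a call of type `i` (`C = 1, 2`) -/
  | busy (i : CallType) (n : ℕ) (x : ℝ)
  /-- server failed while serving a call of type `i` (`C = 3, 4`); that service is interrupted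
  with remaining service time `x` and resumes after the repair -/
  | failed (i : CallType) (n : ℕ) (x y : ℝ)

/-- Number of calls in orbit. -/
def State.orbit : State → ℕ
  | .idle n => n
  | .busy _ n _ => n
  | .failed _ n _ _ => n

/-- The server is idle. -/
def State.IsIdle : State → Prop
  | .idle _ => True
  | .busy _ _ _ => False
  | .failed _ _ _ _ => False

/-- The sources of randomness: unit exponential variables that drive the clocks for incoming
calls, retrials, outgoing calls and server failures; service times; repair times. -/
inductive Source
  | arrival
  | retrial
  | outgoing
  | failure
  | service (i : CallType)
  | repair (i : CallType)
  deriving DecidableEq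

instance fintypeSource : Fintype Source where
  elems := {Source.arrival, Source.retrial, Source.outgoing, Source.failure,
    Source.service .inbound, Source.service .outbound,
    Source.repair .inbound, Source.repair .outbound}
  complete := by
    intro s
    rcases s with _ | _ | _ | _ | i | i <;> first | (cases i <;> simp) | simp

instance isProbabilityMeasure_exp_one : IsProbabilityMeasure (expMeasure 1) :=
  isProbabilityMeasure_expMeasure one_pos

/-- The laws of the sources of randomness. -/
noncomputable def Model.law (Q : Model) : Source → Measure ℝ
  | .arrival => expMeasure 1
  | .retrial => expMeasure 1
  | .outgoing => expMeasure 1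
  | .failure => expMeasure 1
  | .service i => (Q.service i : Measure ℝ)
  | .repair i => (Q.repair i : Measure ℝ)

instance isProbabilityMeasure_law (Q : Model) (s : Source) :
    IsProbabilityMeasure (Q.law s) := by
  cases s <;> (unfold Model.law; infer_instance)

/-- The sample space: a fresh draw of all sources for every transition of the process. -/
abbrev Sample : Type := ℕ → Source → ℝ

/-- All draws are mutually independent. -/
noncomputable def Model.prob (Q : Model) : Measure Sample :=
  Measure.infinitePi fun _ : ℕ => Measure.pi Q.law

instance isProbabilityMeasure_prob (Q : Model) : IsProbabilityMeasure Q.prob := by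
  unfold Model.prob; infer_instance

/-- An exponential clock of rate `q`, obtained by scaling a unit exponential variable `e`.
For `e > 0` a clock of rate `0` shows `∞`, that is, it never rings. -/
noncomputable def clock (q e : ℝ) : ℝ≥0∞ := ENNReal.ofReal e / ENNReal.ofReal q

open Classical in
/-- The state right after the next transition from a given state. The exponential clocks that are
running in that state compete with each other and with the remaining service or repair time:
* idle server, `n` calls in orbit: incoming call (rate `λ`), retrial (rate `n ν`), or outgoing call
  (rate `α`); in each case a service starts;
* busy server: completion of the service, incoming call (rate `λ`, joins the orbit), or failure
  (rate `β_i`);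
* failed server: completion of the repair, or incoming call (rate `λ`, joins the orbit). -/
noncomputable def Model.step (Q : Model) (u : Source → ℝ) : State → State
  | .idle n =>
      let a := clock Q.lam (u .arrival)
      let r := clock (n * Q.nu) (u .retrial)
      let o := clock Q.alpha (u .outgoing)
      if a ≤ r ∧ a ≤ o then .busy .inbound n (u (.service .inbound))
      else if r ≤ o then .busy .inbound (n - 1) (u (.service .inbound))
      else .busy .outbound n (u (.service .outbound))
  | .busy i n x =>
      let a := clock Q.lam (u .arrival)
      let f := clock (Q.beta i) (u .failure)
      if ENNReal.ofReal x ≤ a ∧ ENNReal.ofReal x ≤ f then .idle n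
      else if a ≤ f then .busy i (n + 1) (x - a.toReal)
      else .failed i n (x - f.toReal) (u (.repair i))
  | .failed i n x y =>
      let a := clock Q.lam (u .arrival)
      if ENNReal.ofReal y ≤ a then .busy i n x
      else .failed i (n + 1) x (y - a.toReal)

/-- The state after `m` transitions, when the process starts right after a service completion that
leaves `k` calls in orbit. -/
noncomputable def Model.state (Q : Model) (k : ℕ) (w : Sample) : ℕ → State
  | 0 => .idle k
  | m + 1 => Q.step (w m) (Q.state k w m)

/-- The embedded chain `L_n`: number of calls in orbit right after the `n`-th service completion,
started from `L_0 = k`. The server becomes idle exactly at service completions, so this is the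
orbit size at the `n`-th visit to an idle state (counted from `0`). -/
noncomputable def Model.embedded (Q : Model) (k : ℕ) (n : ℕ) (w : Sample) : ℕ :=
  (Q.state k w (Nat.nth (fun m => (Q.state k w m).IsIdle) n)).orbit

/-- Mean of a law on the real line. -/
noncomputable def mean (ρ : ProbabilityMeasure ℝ) : ℝ := ∫ x, x ∂(ρ : Measure ℝ)

/-- A law of a positive random variable with finite mean. -/
def PositiveWithFiniteMean (ρ : ProbabilityMeasure ℝ) : Prop :=
  (∀ᵐ x ∂(ρ : Measure ℝ), 0 < x) ∧ Integrable (fun x : ℝ => x) (ρ : Measure ℝ)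

end RetrialQueue

namespace DiscreteChain

variable {Ω : Type*} [MeasurableSpace Ω]

/-- `X i n` is the position at time `n` of a process started from `i`. The family is a
time-homogeneous Markov chain: there is a stochastic matrix `p` such that the finite-dimensional
distributions are given by products of its entries. -/
def IsMarkov (P : Measure Ω) (X : ℕ → ℕ → Ω → ℕ) : Prop :=
  (∀ i n, Measurable (X i n)) ∧
  ∃ p : ℕ → ℕ → ℝ≥0∞, (∀ i, ∑' j, p i j = 1) ∧
    ∀ (i n : ℕ) (x : ℕ → ℕ),
      P {w | ∀ m ≤ n, X i m w = x m} =
        if x 0 = i then ∏ m ∈ Finset.range n, p (x m) (x (m + 1)) else 0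

/-- Every state can be reached from every state. -/
def IsIrreducible (P : Measure Ω) (X : ℕ → ℕ → Ω → ℕ) : Prop :=
  ∀ i j, ∃ n, 0 < P {w | X i n w = j}

/-- Every state has period one. -/
def IsAperiodic (P : Measure Ω) (X : ℕ → ℕ → Ω → ℕ) : Prop :=
  ∀ i d : ℕ, (∀ n, 1 ≤ n → 0 < P {w | X i n w = i} → d ∣ n) → d = 1

/-- The time of the first return to the starting point `i`, which is `∞` if there is none. -/
noncomputable def returnTime (X : ℕ → ℕ → Ω → ℕ) (i : ℕ) (w : Ω) : ℝ≥0∞ :=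
  ⨅ n ∈ {n : ℕ | 1 ≤ n ∧ X i n w = i}, (n : ℝ≥0∞)

/-- The mean return time of every state is finite. -/
def IsPositiveRecurrent (P : Measure Ω) (X : ℕ → ℕ → Ω → ℕ) : Prop :=
  ∀ i, ∫⁻ w, returnTime X i w ∂P < ∞

/-- Ergodic chain: irreducible, aperiodic and positive recurrent. -/
def IsErgodic (P : Measure Ω) (X : ℕ → ℕ → Ω → ℕ) : Prop :=
  IsIrreducible P X ∧ IsAperiodic P X ∧ IsPositiveRecurrent P X

end DiscreteChain

/-! ### Killed kernels and mean hitting times on the natural numbers -/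

namespace DiscreteChain

/-! Let ρ_i be the mean number of calls that arrive during a service of type i with its
interruptions, ρ_i = λ μ_{i,1} (1 + β_i γ_{i,1}) (`Model.meanArrivals`). The embedded chain falls by
at most one per step, and from k ≥ 1 its mean increment is P(next service is incoming) ρ_1 + P(next
service is outgoing) ρ_2 - P(a retrial comes first), where served retrials count as incoming
(`tsum_kernel_mul_id`). As k grows, a retrial comes first with probability tending to 1, so the
drift tends to ρ_1 - 1.

If ρ_1 < 1, the drift is eventually below a negative constant, and Foster's criterion
(`exists_isLyapunov_singleton`) bounds the mean return time of every state. If ρ_1 ≥ 1, the drift is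
nonnegative at every k and not only in the limit, because a retrial that comes first leads to a
service of type 1. For a skip-free chain this excludes positive recurrence
(`tsum_avoid_zero_eq_top`). Let K be the kernel killed at 0 and f(k) = k. Then f ≤ K f, so K f(0) ≤
K^n f(0). But k is at most the mean hitting time of 0 from k, so K^n f(0) is at most the tail from n
on of the series ∑ P(T > m) for the return time T to 0. A finite mean return time would thus give K
f(0) = 0, although p(0,1) > 0.

The means ρ_i come from a comparison principle for the one-step operator on the non-idle states
(`Model.Terminates.le_of_subsolution`). Functions that are affine in orbit size, remaining service
time and remaining repair time (`Model.weight`) behave simply under this operator, because a clock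
of rate q rings by time z with probability q times its mean running time (`expMeasure_clock_le`).
One choice of coefficients yields the mean orbit size at the end of a service (`hit_id_busy`);
another loses exactly 1 per transition and shows that services end (`terminates`). The Markov
property also follows from the comparison principle, since bounded solutions of the one-step
equation are determined by their values at the idle states (`Model.Terminates.follow_eq_hit_mul`).
-/

/-- The transition operator of `p`, killed on entering `i`. -/
noncomputable def killed (p : ℕ → ℕ → ℝ≥0∞) (i : ℕ) (f : ℕ → ℝ≥0∞) (j : ℕ) : ℝ≥0∞ :=
  ∑' k, if k = i then 0 else p j k * f k

/-- The probability that the chain started from `j` avoids `i` during the times `1, …, n`. -/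
noncomputable def avoid (p : ℕ → ℕ → ℝ≥0∞) (i n : ℕ) : ℕ → ℝ≥0∞ :=
  (killed p i)^[n] fun _ => 1

section Killed

variable {p : ℕ → ℕ → ℝ≥0∞} {i : ℕ}

theorem avoid_succ (n j : ℕ) : avoid p i (n + 1) j = killed p i (avoid p i n) j := by
  unfold avoid
  rw [Function.iterate_succ_apply']

theorem killed_mono {f g : ℕ → ℝ≥0∞} (h : ∀ k, k ≠ i → f k ≤ g k) (j : ℕ) :
    killed p i f j ≤ killed p i g j := by
  refine ENNReal.tsum_le_tsum fun k => ?_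
  by_cases hk : k = i
  · simp [hk]
  · simp only [hk, if_false]
    gcongr
    exact h k hk

theorem killed_le (f : ℕ → ℝ≥0∞) (j : ℕ) : killed p i f j ≤ ∑' k, p j k * f k := by
  refine ENNReal.tsum_le_tsum fun k => ?_
  split_ifs <;> simp

theorem killed_add (f g : ℕ → ℝ≥0∞) (j : ℕ) :
    killed p i (fun k => f k + g k) j = killed p i f j + killed p i g j := by
  unfold killed
  rw [← ENNReal.tsum_add]
  refine tsum_congr fun k => ?_
  split_ifs <;> simp [mul_add]

theorem killed_tsum (f : ℕ → ℕ → ℝ≥0∞) (j : ℕ) :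
    killed p i (fun k => ∑' n, f n k) j = ∑' n, killed p i (f n) j := by
  unfold killed
  rw [ENNReal.tsum_comm]
  refine tsum_congr fun k => ?_
  split_ifs <;> simp [ENNReal.tsum_mul_left]

/-- The mean hitting time of `i`, expressed by the avoidance probabilities, is bounded by a
Lyapunov function. -/
theorem sum_avoid_le {V : ℕ → ℝ≥0∞} (hV : ∀ j, j ≠ i → ∑' k, p j k * V k + 1 ≤ V j) (N : ℕ)
    (j : ℕ) : j ≠ i → ∑ n ∈ Finset.range N, avoid p i n j ≤ V j := by
  induction N generalizing j with
  | zero => simp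
  | succ N ih =>
    intro hj
    refine le_trans ?_ (hV j hj)
    rw [Finset.sum_range_succ']
    refine add_le_add ?_ (by simp [avoid])
    calc ∑ n ∈ Finset.range N, avoid p i (n + 1) j
        = killed p i (fun k => ∑ n ∈ Finset.range N, avoid p i n k) j := by
          simp only [avoid_succ]
          clear ih
          induction N with
          | zero => simp [killed]
          | succ N ih => simp only [Finset.sum_range_succ, killed_add, ih]
      _ ≤ killed p i V j := killed_mono (fun k hk => ih k hk) j
      _ ≤ _ := killed_le _ _

/-- No drift is needed at `i` itself: after one step the chain is back at `i` or at a state where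
`V` bounds the mean hitting time, and the mean of `V` after that step is finite. -/
theorem tsum_avoid_lt_top {V : ℕ → ℝ≥0∞} (hfin : ∑' k, p i k * V k < ∞)
    (hV : ∀ j, j ≠ i → ∑' k, p j k * V k + 1 ≤ V j) : ∑' n, avoid p i n i < ∞ := by
  have h : ∀ k, k ≠ i → ∑' n, avoid p i n k ≤ V k := by
    intro k hk
    rw [ENNReal.tsum_eq_iSup_nat]
    exact iSup_le fun N => sum_avoid_le hV N k hk
  rw [tsum_eq_zero_add' ENNReal.summable]
  simp only [avoid_succ]
  rw [← killed_tsum]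
  refine ENNReal.add_lt_top.2 ⟨by simp [avoid], ?_⟩
  exact ((killed_mono h i).trans (killed_le _ _)).trans_lt hfin

/-- A chain that decreases by at most one at each step needs at least `j` steps from `j` to `0`. -/
theorem avoid_zero_eq_one (hp : ∀ j, ∑' k, p j k = 1) (hskip : ∀ j k, k + 1 < j → p j k = 0)
    (n j : ℕ) (h : n < j) : avoid p 0 n j = 1 := by
  induction n generalizing j with
  | zero => simp [avoid]
  | succ n ih =>
    rw [avoid_succ, ← hp j]
    refine tsum_congr fun k => ?_
    by_cases hk : k + 1 < j
    · simp [hskip j k hk]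
    · rw [if_neg (by omega), ih k (by omega), mul_one]

/-- A skip-free chain with nonnegative drift is not positive recurrent. -/
theorem tsum_avoid_zero_eq_top (hp : ∀ j, ∑' k, p j k = 1) (hskip : ∀ j k, k + 1 < j → p j k = 0)
    (h01 : p 0 1 ≠ 0) (hdrift : ∀ j : ℕ, (j : ℝ≥0∞) ≤ ∑' k, p j k * (k : ℝ≥0∞)) :
    ∑' n, avoid p 0 n 0 = ∞ := by
  by_contra hfin
  set f : ℕ → ℝ≥0∞ := fun k => (k : ℝ≥0∞)
  -- Killing at 0 costs nothing because `f` vanishes there.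
  have hK : ∀ j, f j ≤ killed p 0 f j := by
    intro j
    refine (hdrift j).trans (le_of_eq (tsum_congr fun k => ?_))
    by_cases hk : k = 0
    · simp [hk]
    · simp [hk, f]
  have hmono : ∀ n j, killed p 0 f j ≤ (killed p 0)^[n + 1] f j := by
    intro n
    induction n with
    | zero => intro j; simp
    | succ n ih =>
      intro j
      rw [Function.iterate_succ_apply']
      exact killed_mono (fun k _ => (hK k).trans (ih k)) j
  -- For n = 0 this says that hitting 0 from j takes at least j steps. Each application of the
  -- killed operator then removes one more term from the front of the series.
  have htail : ∀ n j, (killed p 0)^[n] f j ≤ ∑' m, avoid p 0 (m + n) j := by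
    intro n
    induction n with
    | zero =>
      intro j
      simp only [Function.iterate_zero, id, add_zero]
      calc f j = ∑ m ∈ Finset.range j, avoid p 0 m j := by
            rw [Finset.sum_congr rfl fun m hm =>
              avoid_zero_eq_one hp hskip m j (Finset.mem_range.1 hm)]
            simp [f]
        _ ≤ _ := ENNReal.sum_le_tsum _
    | succ n ih =>
      intro j
      rw [Function.iterate_succ_apply']
      refine (killed_mono (fun k _ => ih k) j).trans ?_
      rw [killed_tsum]
      refine le_of_eq (tsum_congr fun m => ?_)
      rw [← add_assoc, avoid_succ]
  have hlim := (tendsto_add_atTop_iff_nat 1).2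
    (ENNReal.tendsto_sum_nat_add (fun m => avoid p 0 m 0) hfin)
  have h0 : killed p 0 f 0 ≤ 0 :=
    ge_of_tendsto' hlim fun n => (hmono n 0).trans (htail (n + 1) 0)
  have h1 : p 0 1 ≤ killed p 0 f 0 := by
    refine le_trans ?_ (ENNReal.le_tsum 1)
    simp [f]
  exact h01 (le_antisymm (h1.trans h0) bot_le)

end Killed

/-! ### Lyapunov functions and Foster's criterion -/

/-- `V` is a Lyapunov function for `p` outside the set `E` of exceptional states. -/
def IsLyapunov (p : ℕ → ℕ → ℝ≥0∞) (E : Set ℕ) (V : ℕ → ℝ≥0∞) : Prop :=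
  (∀ j, ∑' k, p j k * V k < ∞) ∧ ∀ j, j ∉ E → ∑' k, p j k * V k + 1 ≤ V j

section Lyapunov

variable {p : ℕ → ℕ → ℝ≥0∞}

/-- An exceptional state can be removed by raising the Lyapunov function on a set that can be left
from that state and that cannot be entered. -/
theorem IsLyapunov.remove (hp : ∀ j, ∑' k, p j k = 1) {E E' A : Set ℕ} {V : ℕ → ℝ≥0∞}
    (hV : IsLyapunov p E V) {e b : ℕ} (heA : e ∈ A) (hb : b ∉ A) (hpe : p e b ≠ 0)
    (hA : ∀ j k, j ∉ A → j ∉ E' → k ∈ A → p j k = 0) (hE : ∀ j, j ∉ E' → j ≠ e → j ∉ E) :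
    ∃ V', IsLyapunov p E' V' := by
  classical
  -- The raise is so large that the chance `p e b` of leaving `A` from `e` alone pays for the
  -- one-step mean of `V` and the required decrease 1.
  set D : ℝ≥0∞ := (∑' k, p e k * V k + 1) / p e b with hD
  have hpe_top : p e b ≠ ∞ := ne_top_of_le_ne_top (by simp [hp]) (ENNReal.le_tsum (f := p e) b)
  have hDtop : D ≠ ∞ := by
    refine ENNReal.div_ne_top ?_ hpe
    exact ENNReal.add_ne_top.2 ⟨(hV.1 e).ne, by simp⟩
  have hDmul : D * p e b = ∑' k, p e k * V k + 1 := ENNReal.div_mul_cancel hpe hpe_top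
  set V' : ℕ → ℝ≥0∞ := fun k => V k + if k ∈ A then D else 0
  have hsum : ∀ j, ∑' k, p j k * V' k =
      ∑' k, p j k * V k + ∑' k, p j k * (if k ∈ A then D else 0) := by
    intro j
    simp only [V', mul_add, ENNReal.tsum_add]
  have hle : ∀ j, ∑' k, p j k * (if k ∈ A then D else 0) ≤ D := by
    intro j
    calc _ ≤ ∑' k, p j k * D := ENNReal.tsum_le_tsum fun k => by split_ifs <;> simp
      _ = D := by rw [ENNReal.tsum_mul_right, hp, one_mul]
  refine ⟨V', fun j => ?_, fun j hj => ?_⟩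
  · rw [hsum]
    exact ENNReal.add_lt_top.2 ⟨hV.1 j, (hle j).trans_lt hDtop.lt_top⟩
  · rw [hsum]
    by_cases hje : j = e
    · subst hje
      simp only [V', if_pos heA]
      refine le_trans ?_ le_add_self
      calc _ = ∑' k, p j k * (if k ∈ A then D else 0) + D * p j b := by rw [hDmul]; ring
        _ ≤ ∑' k, p j k * (if k ∈ A then D else 0) + ∑' k, p j k * (if k ∈ A then 0 else D) := by
          gcongr
          refine le_trans ?_ (ENNReal.le_tsum b)
          rw [if_neg hb, mul_comm]
        _ = ∑' k, p j k * D := by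
          rw [← ENNReal.tsum_add]
          refine tsum_congr fun k => ?_
          split_ifs <;> simp
        _ = D := by rw [ENNReal.tsum_mul_right, hp, one_mul]
    · have hj' := hV.2 j (hE j hj hje)
      by_cases hjA : j ∈ A
      · simp only [V', if_pos hjA]
        calc _ ≤ ∑' k, p j k * V k + D + 1 := by gcongr; exact hle j
          _ = (∑' k, p j k * V k + 1) + D := by ring
          _ ≤ _ := add_le_add hj' le_rfl
      · have h0 : ∑' k, p j k * (if k ∈ A then D else 0) = 0 := by
          refine ENNReal.tsum_eq_zero.2 fun k => ?_
          split_ifs with hk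
          · rw [hA j k hjA hj hk, zero_mul]
          · simp
        simp only [V', if_neg hjA, h0, add_zero]
        exact hj'

/-- Foster's criterion for a skip-free chain. -/
theorem exists_isLyapunov_singleton (hp : ∀ j, ∑' k, p j k = 1)
    (hskip : ∀ j k, k + 1 < j → p j k = 0) (hup : ∀ j, p j (j + 1) ≠ 0)
    (hdown : ∀ j, p (j + 1) j ≠ 0) (hfin : ∀ j, ∑' k, p j k * (k : ℝ≥0∞) < ∞)
    {ε : ℝ≥0∞} (hε : ε ≠ 0) (hε' : ε ≠ ∞) {N : ℕ}
    (hdrift : ∀ j : ℕ, N ≤ j → ∑' k, p j k * (k : ℝ≥0∞) + ε ≤ j) (i : ℕ) :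
    ∃ V, IsLyapunov p {i} V := by
  -- Rescaling the identity by ε⁻¹ turns the drift -ε into -1 beyond `N`.
  have base : ∃ V, IsLyapunov p {j | j ≤ i + N} V := by
    have hmul : ∀ j, ∑' k, p j k * ((k : ℝ≥0∞) * ε⁻¹) = (∑' k, p j k * (k : ℝ≥0∞)) * ε⁻¹ := by
      intro j
      rw [← ENNReal.tsum_mul_right]
      exact tsum_congr fun k => by ring
    refine ⟨fun k => (k : ℝ≥0∞) * ε⁻¹, fun j => ?_, fun j hj => ?_⟩
    · rw [hmul]
      exact ENNReal.mul_lt_top (hfin j) (ENNReal.inv_lt_top.2 (pos_iff_ne_zero.2 hε))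
    · rw [hmul]
      simp only [Set.mem_ofPred_eq, not_le] at hj
      calc _ = (∑' k, p j k * (k : ℝ≥0∞) + ε) * ε⁻¹ := by
            rw [add_mul, ENNReal.mul_inv_cancel hε hε']
        _ ≤ _ := mul_le_mul_left (hdrift j (by omega)) _
  -- Exceptional states above `i` are removed from the highest down. Every state outside `A` is
  -- still exceptional, so the condition on entering `A` is void.
  have top : ∀ n, (∃ V, IsLyapunov p {j | j ≤ i + n} V) → ∃ V, IsLyapunov p {j | j ≤ i} V := by
    intro n
    induction n with
    | zero => exact id
    | succ n ih =>
      rintro ⟨V, hV⟩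
      refine ih (hV.remove hp (A := {j | i + n < j}) (e := i + n + 1) (b := i + n) ?_ ?_ ?_ ?_ ?_)
      · simp
      · simp
      · exact hdown _
      · intro j k h1 h2
        simp only [Set.mem_ofPred_eq] at h1 h2
        omega
      · intro j h1 h2
        simp only [Set.mem_ofPred_eq] at h1 ⊢
        omega
  -- States below `i` are removed from 0 upwards. A state above `i` cannot jump to `n` or below,
  -- since `n < i` and the chain is skip-free.
  have bottom : ∀ n, n ≤ i → ∃ V, IsLyapunov p {j | n ≤ j ∧ j ≤ i} V := by
    intro n
    induction n with
    | zero => intro _; simpa using top N base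
    | succ n ih =>
      intro hn
      obtain ⟨V, hV⟩ := ih (by omega)
      refine hV.remove hp (A := {j | j ≤ n}) (e := n) (b := n + 1) ?_ ?_ ?_ ?_ ?_
      · simp
      · simp
      · exact hup _
      · intro j k h1 h2 h3
        simp only [Set.mem_ofPred_eq] at h1 h2 h3
        exact hskip j k (by omega)
      · intro j h1 h2
        simp only [Set.mem_ofPred_eq] at h1 ⊢
        omega
  obtain ⟨V, hV⟩ := bottom i le_rfl
  refine ⟨V, hV.1, fun j hj => hV.2 j ?_⟩
  simp only [Set.mem_ofPred_eq, Set.mem_singleton_iff] at hj ⊢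
  omega

end Lyapunov

/-! ### Return times and path probabilities -/

/-- A time with values in ℕ ∪ {∞} equals the number of integers n ≥ 0 that it exceeds; without a
return both sides are infinite. -/
theorem returnTime_eq_tsum {Ω : Type*} {X : ℕ → ℕ → Ω → ℕ} (i : ℕ) (w : Ω) :
    returnTime X i w =
      ∑' n : ℕ, Set.indicator {w | ∀ m, 0 < m → m ≤ n → X i m w ≠ i} (fun _ => (1 : ℝ≥0∞)) w := by
  classical
  unfold returnTime
  by_cases h : ∃ n, 1 ≤ n ∧ X i n w = i
  · have hspec := Nat.find_spec h
    have hval : ∀ n, Set.indicator {w | ∀ m, 0 < m → m ≤ n → X i m w ≠ i}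
        (fun _ => (1 : ℝ≥0∞)) w = if n < Nat.find h then 1 else 0 := by
      intro n
      rw [Set.indicator_apply]
      congr 1
      simp only [Set.mem_ofPred_eq, eq_iff_iff]
      constructor
      · intro hn
        by_contra hlt
        exact hn _ hspec.1 (not_lt.1 hlt) hspec.2
      · intro hn m hm hmn heq
        exact Nat.find_min h (lt_of_le_of_lt hmn hn) ⟨hm, heq⟩
    rw [tsum_congr hval, tsum_eq_sum (s := Finset.range (Nat.find h))]
    · rw [Finset.sum_congr rfl fun n hn => if_pos (Finset.mem_range.1 hn)]
      simp only [Finset.sum_const, Finset.card_range, nsmul_eq_mul, mul_one]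
      refine le_antisymm (iInf₂_le (Nat.find h) hspec) (le_iInf₂ fun n hn => ?_)
      exact_mod_cast Nat.find_min' h hn
    · intro n hn
      rw [if_neg (by simpa using hn)]
  · push Not at h
    have hval : ∀ n, Set.indicator {w | ∀ m, 0 < m → m ≤ n → X i m w ≠ i}
        (fun _ => (1 : ℝ≥0∞)) w = 1 := fun n =>
      Set.indicator_of_mem (Set.mem_ofPred.2 fun m hm _ => h m hm) _
    rw [tsum_congr hval, ENNReal.tsum_const_eq_top_of_ne_zero one_ne_zero]
    simp only [Set.mem_ofPred_eq, iInf_eq_top]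
    exact fun n hn => absurd hn.2 (h n hn.1)

section Path

variable {Ω : Type*} [MeasurableSpace Ω] {P : Measure Ω} {X : ℕ → ℕ → Ω → ℕ}
  {p : ℕ → ℕ → ℝ≥0∞}

/-- The Markov property for an avoidance event, obtained from cylinder probabilities alone: split by
the position at time `n + 1` and extend the prescribed path by it. -/
theorem measure_cylinder_avoid (hX : ∀ i n, Measurable (X i n))
    (hcyl : ∀ (i n : ℕ) (x : ℕ → ℕ), P {w | ∀ m ≤ n, X i m w = x m} =
      if x 0 = i then ∏ m ∈ Finset.range n, p (x m) (x (m + 1)) else 0)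
    (i s k : ℕ) : ∀ (n : ℕ) (x : ℕ → ℕ),
    P {w | (∀ m ≤ n, X s m w = x m) ∧ ∀ m, n < m → m ≤ n + k → X s m w ≠ i} =
      P {w | ∀ m ≤ n, X s m w = x m} * avoid p i k (x n) := by
  induction k with
  | zero =>
    intro n x
    simp only [avoid, Function.iterate_zero, id, mul_one, add_zero]
    congr 1
    ext w
    simp only [Set.mem_ofPred_eq, and_iff_left_iff_imp]
    intro _ m h1 h2
    omega
  | succ k ih =>
    intro n x
    have hmeas : ∀ (N : ℕ) (y : ℕ → ℕ), MeasurableSet {w | ∀ m ≤ N, X s m w = y m} := by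
      intro N y
      have : {w | ∀ m ≤ N, X s m w = y m} = ⋂ m, ⋂ (_ : m ≤ N), X s m ⁻¹' {y m} := by
        ext w; simp
      rw [this]
      exact .iInter fun m => .iInter fun _ => hX s m (measurableSet_singleton _)
    have hmeas' : ∀ (N M : ℕ) (y : ℕ → ℕ), MeasurableSet
        {w | (∀ m ≤ N, X s m w = y m) ∧ ∀ m, N < m → m ≤ M → X s m w ≠ i} := by
      intro N M y
      have : {w | (∀ m ≤ N, X s m w = y m) ∧ ∀ m, N < m → m ≤ M → X s m w ≠ i} =
          {w | ∀ m ≤ N, X s m w = y m} ∩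
            ⋂ m, ⋂ (_ : N < m), ⋂ (_ : m ≤ M), X s m ⁻¹' {i}ᶜ := by
        ext w; simp
      rw [this]
      exact (hmeas N y).inter (.iInter fun m => .iInter fun _ => .iInter fun _ =>
        hX s m (measurableSet_singleton _).compl)
    -- `Function.update` records position `j` at time `n + 1`; `j = i` is excluded, which matches
    -- the killing in `avoid`.
    set B : ℕ → Set Ω := fun j => if j = i then ∅ else
      {w | (∀ m ≤ n + 1, X s m w = Function.update x (n + 1) j m) ∧
        ∀ m, n + 1 < m → m ≤ n + 1 + k → X s m w ≠ i} with hB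
    have hBX : ∀ j w, w ∈ B j → X s (n + 1) w = j := by
      intro j w hw
      simp only [hB] at hw
      split_ifs at hw with hj
      · exact hw.elim
      · simpa using hw.1 (n + 1) le_rfl
    have hsplit : {w | (∀ m ≤ n, X s m w = x m) ∧ ∀ m, n < m → m ≤ n + (k + 1) → X s m w ≠ i} =
        ⋃ j, B j := by
      ext w
      simp only [Set.mem_ofPred_eq, Set.mem_iUnion]
      constructor
      · rintro ⟨h1, h2⟩
        refine ⟨X s (n + 1) w, ?_⟩
        simp only [hB]
        rw [if_neg (h2 (n + 1) (by omega) (by omega))]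
        refine ⟨fun m hm => ?_, fun m hm hm' => h2 m (by omega) (by omega)⟩
        by_cases hmn : m = n + 1
        · subst hmn; simp
        · rw [Function.update_of_ne hmn]; exact h1 m (by omega)
      · rintro ⟨j, hj⟩
        have hjX := hBX j w hj
        simp only [hB] at hj
        split_ifs at hj with hji
        · exact hj.elim
        · refine ⟨fun m hm => ?_, fun m hm hm' => ?_⟩
          · have := hj.1 m (by omega)
            rwa [Function.update_of_ne (by omega)] at this
          · by_cases hmn : m = n + 1
            · subst hmn; rw [hjX]; exact hji
            · exact hj.2 m (by omega) (by omega)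
    have hdisj : Pairwise (Function.onFun Disjoint B) := by
      intro a b hab
      refine Set.disjoint_left.2 fun w ha hb => hab ?_
      rw [← hBX a w ha, hBX b w hb]
    have hBm : ∀ j, MeasurableSet (B j) := by
      intro j
      simp only [hB]
      split_ifs
      · exact .empty
      · exact hmeas' _ _ _
    rw [hsplit, measure_iUnion hdisj hBm, avoid_succ]
    unfold killed
    rw [← ENNReal.tsum_mul_left]
    refine tsum_congr fun j => ?_
    by_cases hj : j = i
    · simp [hB, hj]
    · simp only [hB, if_neg hj]
      rw [ih (n + 1), hcyl, hcyl, Function.update_self, Function.update_of_ne (by omega)]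
      split_ifs
      · rw [Finset.prod_range_succ, Function.update_self, Function.update_of_ne (by omega),
          mul_assoc]
        congr 1
        refine Finset.prod_congr rfl fun m hm => ?_
        have := Finset.mem_range.1 hm
        rw [Function.update_of_ne (by omega), Function.update_of_ne (by omega)]
      · simp

theorem lintegral_returnTime (hX : ∀ i n, Measurable (X i n))
    (hcyl : ∀ (i n : ℕ) (x : ℕ → ℕ), P {w | ∀ m ≤ n, X i m w = x m} =
      if x 0 = i then ∏ m ∈ Finset.range n, p (x m) (x (m + 1)) else 0)
    (i : ℕ) [IsProbabilityMeasure P] : ∫⁻ w, returnTime X i w ∂P = ∑' n, avoid p i n i := by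
  have hmeas : ∀ n, MeasurableSet {w | ∀ m, 0 < m → m ≤ n → X i m w ≠ i} := by
    intro n
    have : {w | ∀ m, 0 < m → m ≤ n → X i m w ≠ i} =
        ⋂ m, ⋂ (_ : 0 < m), ⋂ (_ : m ≤ n), X i m ⁻¹' {i}ᶜ := by
      ext w; simp
    rw [this]
    exact .iInter fun m => .iInter fun _ => .iInter fun _ =>
      hX i m (measurableSet_singleton _).compl
  have h0 : P {w | ∀ m ≤ 0, X i m w = i} = 1 := by
    have := hcyl i 0 fun _ => i
    simpa using this
  simp only [returnTime_eq_tsum]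
  rw [lintegral_tsum fun n => (measurable_const.indicator (hmeas n)).aemeasurable]
  refine tsum_congr fun n => ?_
  rw [lintegral_indicator_const (hmeas n), one_mul]
  have key := measure_cylinder_avoid hX hcyl i i n 0 fun _ => i
  rw [h0, one_mul] at key
  rw [← key]
  -- The cylinder formula places the chain at `i` at time 0 only almost surely, so the two events
  -- agree up to a null set.
  have hae : ∀ᵐ w ∂P, ∀ m ≤ 0, X i m w = i := by
    rw [← prob_compl_eq_zero_iff₀] at h0
    · exact h0
    · have : {w | ∀ m ≤ 0, X i m w = i} = X i 0 ⁻¹' {i} := by ext w; simp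
      rw [this]
      exact (hX i 0 (measurableSet_singleton _)).nullMeasurableSet
  refine measure_congr ?_
  filter_upwards [hae] with w hw
  refine propext ?_
  change (∀ m, 0 < m → m ≤ n → X i m w ≠ i) ↔
    (∀ m ≤ 0, X i m w = i) ∧ ∀ m, 0 < m → m ≤ 0 + n → X i m w ≠ i
  rw [zero_add]
  exact ⟨fun h => ⟨hw, h⟩, fun h => h.2⟩

end Path

/-! ### Irreducibility and aperiodicity from positive entries -/

section Criteria

variable {Ω : Type*} [MeasurableSpace Ω] {P : Measure Ω} {X : ℕ → ℕ → Ω → ℕ}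
  {p : ℕ → ℕ → ℝ≥0∞}

theorem measure_pos_of_path
    (hcyl : ∀ (i n : ℕ) (x : ℕ → ℕ), P {w | ∀ m ≤ n, X i m w = x m} =
      if x 0 = i then ∏ m ∈ Finset.range n, p (x m) (x (m + 1)) else 0)
    (n : ℕ) (x : ℕ → ℕ) (h : ∀ m < n, p (x m) (x (m + 1)) ≠ 0) :
    0 < P {w | X (x 0) n w = x n} := by
  have h1 : 0 < P {w | ∀ m ≤ n, X (x 0) m w = x m} := by
    rw [hcyl, if_pos rfl, pos_iff_ne_zero, Finset.prod_ne_zero_iff]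
    exact fun m hm => h m (Finset.mem_range.1 hm)
  exact h1.trans_le (measure_mono fun w hw => hw n le_rfl)

theorem isIrreducible_of_step
    (hcyl : ∀ (i n : ℕ) (x : ℕ → ℕ), P {w | ∀ m ≤ n, X i m w = x m} =
      if x 0 = i then ∏ m ∈ Finset.range n, p (x m) (x (m + 1)) else 0)
    (hup : ∀ j, p j (j + 1) ≠ 0) (hdown : ∀ j, p (j + 1) j ≠ 0) : IsIrreducible P X := by
  intro i j
  rcases le_total i j with hij | hij
  · refine ⟨j - i, ?_⟩
    have := measure_pos_of_path hcyl (j - i) (fun m => i + m) fun m _ => hup (i + m)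
    simpa [Nat.add_sub_cancel' hij] using this
  · refine ⟨i - j, ?_⟩
    have := measure_pos_of_path hcyl (i - j) (fun m => i - m) fun m hm => by
      have h := hdown (i - (m + 1))
      rwa [show i - (m + 1) + 1 = i - m by omega] at h
    simpa [Nat.sub_sub_self hij] using this

theorem isAperiodic_of_stay
    (hcyl : ∀ (i n : ℕ) (x : ℕ → ℕ), P {w | ∀ m ≤ n, X i m w = x m} =
      if x 0 = i then ∏ m ∈ Finset.range n, p (x m) (x (m + 1)) else 0)
    (hstay : ∀ j, p j j ≠ 0) : IsAperiodic P X := by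
  intro i d h
  exact Nat.dvd_one.1 (h 1 le_rfl (measure_pos_of_path hcyl 1 (fun _ => i) fun _ _ => hstay i))

end Criteria

end DiscreteChain

/-! ### Shifting and measuring `Nat.nth` -/

section Nth

/-- A time shift past an index that counts lowers the rank by one. Infinitude keeps `Nat.nth` away
from its default value 0, for which the identity would fail. -/
theorem Nat.nth_succ_eq_of_infinite {p : ℕ → Prop} (hinf : {m | p (m + 1)}.Infinite) (h0 : p 0) (n : ℕ) :
    Nat.nth p (n + 1) = Nat.nth (fun m => p (m + 1)) n + 1 := by
  classical
  set x := Nat.nth (fun m => p (m + 1)) n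
  have hx : p (x + 1) := Nat.nth_mem_of_infinite hinf n
  have hc : Nat.count p (x + 1) = n + 1 := by
    rw [Nat.count_succ', if_pos h0, Nat.count_nth_of_infinite hinf]
  rw [← hc, Nat.nth_count hx]

theorem Nat.nth_eq_of_infinite_of_not {p : ℕ → Prop} (hinf : {m | p (m + 1)}.Infinite) (h0 : ¬ p 0)
    (n : ℕ) : Nat.nth p n = Nat.nth (fun m => p (m + 1)) n + 1 := by
  classical
  set x := Nat.nth (fun m => p (m + 1)) n
  have hx : p (x + 1) := Nat.nth_mem_of_infinite hinf n
  have hc : Nat.count p (x + 1) = n := by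
    rw [Nat.count_succ', if_neg h0, Nat.count_nth_of_infinite hinf, add_zero]
  conv_lhs => rw [← hc]
  rw [Nat.nth_count hx]

theorem Nat.nth_zero_eq_zero {p : ℕ → Prop} (h0 : p 0) : Nat.nth p 0 = 0 := by
  classical
  simpa using Nat.nth_count (p := p) h0

theorem measurable_nat_sInf {α : Type*} [MeasurableSpace α] {q : ℕ → α → Prop}
    (hq : ∀ m, MeasurableSet {a | q m a}) : Measurable fun a => sInf {m | q m a} := by
  refine measurable_to_countable' fun m => ?_
  -- The second set of the union accounts for `sInf ∅ = 0`.
  have : (fun a => sInf {m | q m a}) ⁻¹' {m} =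
      ({a | q m a} ∩ ⋂ x, ⋂ (_ : x < m), {a | q x a}ᶜ) ∪
        ({_a | m = 0} ∩ ⋂ x, {a | q x a}ᶜ) := by
    ext a
    simp only [Set.mem_preimage, Set.mem_singleton_iff, Set.mem_union, Set.mem_inter_iff,
      Set.mem_ofPred_eq, Set.mem_iInter, Set.mem_compl_iff]
    constructor
    · intro h
      by_cases hne : {m | q m a}.Nonempty
      · left
        refine ⟨?_, fun x hx hqx => ?_⟩
        · have := Nat.sInf_mem hne
          rwa [h] at this
        · have : sInf {m | q m a} ≤ x := Nat.sInf_le hqx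
          omega
      · right
        rw [Set.not_nonempty_iff_eq_empty] at hne
        refine ⟨by rw [← h, hne, Nat.sInf_empty], fun x hx => ?_⟩
        have : x ∈ {m | q m a} := hx
        simp [hne] at this
    · rintro (⟨h1, h2⟩ | ⟨h1, h2⟩)
      · refine le_antisymm (Nat.sInf_le h1) ?_
        by_contra hlt
        exact h2 _ (not_le.1 hlt) (Nat.sInf_mem (s := {m | q m a}) ⟨m, h1⟩)
      · have : {m | q m a} = ∅ := Set.eq_empty_of_forall_notMem h2
        rw [this, Nat.sInf_empty, h1]
  rw [this]
  exact ((hq m).inter (.iInter fun x => .iInter fun _ => (hq x).compl)).union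
    ((MeasurableSet.const _).inter (.iInter fun x => (hq x).compl))

theorem measurable_nat_nth {α : Type*} [MeasurableSpace α] {q : ℕ → α → Prop}
    (hq : ∀ m, MeasurableSet {a | q m a}) (n : ℕ) :
    Measurable fun a => Nat.nth (fun m => q m a) n := by
  induction n using Nat.strong_induction_on with
  | _ n ih =>
    have : (fun a => Nat.nth (fun m => q m a) n) =
        fun a => sInf {x | q x a ∧ ∀ k < n, Nat.nth (fun m => q m a) k < x} := by
      funext a
      rw [Nat.nth_eq_sInf]
    rw [this]
    refine measurable_nat_sInf fun m => ?_
    have h2 : {a | q m a ∧ ∀ k < n, Nat.nth (fun m => q m a) k < m} =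
        {a | q m a} ∩ ⋂ k, ⋂ (_ : k < n), (fun a => Nat.nth (fun m => q m a) k) ⁻¹' Set.Iio m := by
      ext a; simp
    rw [h2]
    exact (hq m).inter (.iInter fun k => .iInter fun hk => ih k hk measurableSet_Iio)

end Nth

/-! ### Measurability of the state process and first-step analysis -/

namespace RetrialQueue

instance measurableSpaceCallType : MeasurableSpace CallType := ⊤

/-- A state as a discrete component together with the remaining service and repair times. -/
def State.encode : State → (Option (CallType × Bool) × ℕ) × ℝ × ℝ
  | .idle n => ((none, n), 0, 0)
  | .busy i n x => ((some (i, false), n), x, 0)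
  | .failed i n x y => ((some (i, true), n), x, y)

/-- The left inverse of `State.encode`. -/
def State.decode : (Option (CallType × Bool) × ℕ) × ℝ × ℝ → State
  | ((none, n), _, _) => .idle n
  | ((some (i, false), n), x, _) => .busy i n x
  | ((some (i, true), n), x, y) => .failed i n x y

theorem State.decode_encode (s : State) : State.decode s.encode = s := by
  cases s <;> rfl

instance measurableSpaceMode : MeasurableSpace (Option (CallType × Bool)) := ⊤

instance measurableSingletonClassMode : MeasurableSingletonClass (Option (CallType × Bool)) :=
  ⟨fun _ => trivial⟩

instance measurableSpaceState : MeasurableSpace State :=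
  MeasurableSpace.comap State.encode inferInstance

theorem State.measurable_encode : Measurable State.encode := comap_measurable _

theorem measurable_of_encode {α : Type*} [MeasurableSpace α] {f : α → State}
    (h : Measurable fun a => (f a).encode) : Measurable f :=
  measurable_comap_iff.2 h

theorem measurable_busy {α : Type*} [MeasurableSpace α] (i : CallType) (n : ℕ) {x : α → ℝ}
    (hx : Measurable x) : Measurable fun a => State.busy i n (x a) :=
  measurable_of_encode (by simp only [State.encode]; fun_prop)

theorem measurable_failed {α : Type*} [MeasurableSpace α] (i : CallType) (n : ℕ) {x y : α → ℝ}
    (hx : Measurable x) (hy : Measurable y) : Measurable fun a => State.failed i n (x a) (y a) :=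
  measurable_of_encode (by simp only [State.encode]; fun_prop)

/-- The discrete component of a state has countably many values, so measurability may be tested on
each of them in the continuous variables. -/
theorem measurable_state_prod {α γ : Type*} [MeasurableSpace α] [MeasurableSpace γ]
    {f : State × α → γ} (hidle : ∀ n, Measurable fun a => f (.idle n, a))
    (hbusy : ∀ i n, Measurable fun q : ℝ × α => f (.busy i n q.1, q.2))
    (hfailed : ∀ i n, Measurable fun q : (ℝ × ℝ) × α => f (.failed i n q.1.1 q.1.2, q.2)) :
    Measurable f := by
  have h : Measurable fun q : (Option (CallType × Bool) × ℕ) × (ℝ × ℝ) × α =>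
      f (State.decode (q.1, q.2.1), q.2.2) := by
    refine measurable_from_prod_countable_right fun d => ?_
    rcases d with ⟨_ | ⟨i, _ | _⟩, n⟩
    · exact (hidle n).comp measurable_snd
    · exact (hbusy i n).comp ((measurable_fst.comp measurable_fst).prodMk measurable_snd)
    · exact hfailed i n
  have h2 : Measurable fun q : State × α => (q.1.encode.1, q.1.encode.2, q.2) := by
    have := State.measurable_encode.comp
      (measurable_fst : Measurable (Prod.fst : State × α → State))
    exact (measurable_fst.comp this).prodMk ((measurable_snd.comp this).prodMk measurable_snd)
  have h3 := h.comp h2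
  have h4 : (fun q : (Option (CallType × Bool) × ℕ) × (ℝ × ℝ) × α =>
      f (State.decode (q.1, q.2.1), q.2.2)) ∘ (fun q : State × α =>
        (q.1.encode.1, q.1.encode.2, q.2)) = f := by
    funext q
    simp [State.decode_encode]
  rwa [h4] at h3

theorem measurable_state {γ : Type*} [MeasurableSpace γ] {f : State → γ}
    (hbusy : ∀ i n, Measurable fun x => f (.busy i n x))
    (hfailed : ∀ i n, Measurable fun q : ℝ × ℝ => f (.failed i n q.1 q.2)) :
    Measurable f := by
  have h : Measurable fun q : State × Unit => f q.1 :=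
    measurable_state_prod (fun n => (measurable_const : Measurable fun _ : Unit => f (.idle n)))
      (fun i n => (hbusy i n).comp measurable_fst)
      (fun i n => (hfailed i n).comp measurable_fst)
  exact h.comp (measurable_id.prodMk (measurable_const (a := ())))

theorem measurable_orbit : Measurable State.orbit :=
  measurable_state (fun _ _ => measurable_const) fun _ _ => measurable_const

theorem measurableSet_isIdle : MeasurableSet {s : State | s.IsIdle} := by
  have : Measurable State.IsIdle :=
    measurable_state (fun _ _ => measurable_const) fun _ _ => measurable_const
  exact measurableSet_setOfPred.2 this

variable (Q : Model)

theorem measurable_clock (q : ℝ) : Measurable (clock q) := by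
  unfold clock; fun_prop

theorem measurable_step : Measurable fun q : State × (Source → ℝ) => Q.step q.2 q.1 := by
  have hc : ∀ {α : Type} [MeasurableSpace α] (r : ℝ) (s : Source) {g : α → Source → ℝ},
      Measurable g → Measurable fun a => clock r (g a s) := fun r s g hg =>
    (measurable_clock r).comp ((measurable_pi_apply s).comp hg)
  refine measurable_state_prod (fun n => ?_) (fun i n => ?_) (fun i n => ?_)
  · have a := hc Q.lam .arrival (measurable_id (α := Source → ℝ))
    have r := hc (n * Q.nu) .retrial (measurable_id (α := Source → ℝ))
    have o := hc Q.alpha .outgoing (measurable_id (α := Source → ℝ))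
    refine Measurable.ite ((measurableSet_le a r).inter (measurableSet_le a o))
      (measurable_busy _ _ (measurable_pi_apply _)) ?_
    exact Measurable.ite (measurableSet_le r o)
      (measurable_busy _ _ (measurable_pi_apply _)) (measurable_busy _ _ (measurable_pi_apply _))
  · have a := hc Q.lam .arrival (measurable_snd (α := ℝ) (β := Source → ℝ))
    have f := hc (Q.beta i) .failure (measurable_snd (α := ℝ) (β := Source → ℝ))
    have x : Measurable fun q : ℝ × (Source → ℝ) => ENNReal.ofReal q.1 :=
      ENNReal.measurable_ofReal.comp measurable_fst
    refine Measurable.ite ((measurableSet_le x a).inter (measurableSet_le x f))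
      measurable_const ?_
    exact Measurable.ite (measurableSet_le a f)
      (measurable_busy _ _ (measurable_fst.sub a.ennreal_toReal))
      (measurable_failed _ _ (measurable_fst.sub f.ennreal_toReal)
        ((measurable_pi_apply _).comp measurable_snd))
  · have a := hc Q.lam .arrival (measurable_snd (α := ℝ × ℝ) (β := Source → ℝ))
    have y : Measurable fun q : (ℝ × ℝ) × (Source → ℝ) => ENNReal.ofReal q.1.2 :=
      ENNReal.measurable_ofReal.comp (measurable_snd.comp measurable_fst)
    have x : Measurable fun q : (ℝ × ℝ) × (Source → ℝ) => q.1.1 :=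
      measurable_fst.comp measurable_fst
    exact Measurable.ite (measurableSet_le y a)
      (measurable_busy _ _ x)
      (measurable_failed _ _ x
        ((measurable_snd.comp measurable_fst).sub a.ennreal_toReal))

/-- The law of the draws that are used in one transition. -/
noncomputable abbrev Model.draw : Measure (Source → ℝ) := Measure.pi Q.law

/-- The transition operator of the Markov process. -/
noncomputable def Model.trans (f : State → ℝ≥0∞) (s : State) : ℝ≥0∞ :=
  ∫⁻ u, f (Q.step u s) ∂Q.draw

theorem measurable_step_left (s : State) : Measurable fun u => Q.step u s :=
  (measurable_step Q).comp (measurable_const.prodMk measurable_id)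

theorem measurable_trans {f : State → ℝ≥0∞} (hf : Measurable f) : Measurable (Q.trans f) :=
  (hf.comp (measurable_step Q)).lintegral_prod_right'

theorem trans_mono {f g : State → ℝ≥0∞} {s : State} (h : ∀ u, f (Q.step u s) ≤ g (Q.step u s)) :
    Q.trans f s ≤ Q.trans g s := lintegral_mono h

theorem trans_add {f g : State → ℝ≥0∞} (hf : Measurable f) (s : State) :
    Q.trans (fun s => f s + g s) s = Q.trans f s + Q.trans g s :=
  lintegral_add_left (hf.comp (measurable_step_left Q s)) _

theorem trans_const_mul {f : State → ℝ≥0∞} (hf : Measurable f) (c : ℝ≥0∞) (s : State) :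
    Q.trans (fun s => c * f s) s = c * Q.trans f s :=
  lintegral_const_mul _ (hf.comp (measurable_step_left Q s))

theorem trans_mul_const {f : State → ℝ≥0∞} (hf : Measurable f) (c : ℝ≥0∞) (s : State) :
    Q.trans (fun s => f s * c) s = Q.trans f s * c :=
  lintegral_mul_const _ (hf.comp (measurable_step_left Q s))

theorem trans_tsum {f : ℕ → State → ℝ≥0∞} (hf : ∀ n, Measurable (f n)) (s : State) :
    Q.trans (fun s => ∑' n, f n s) s = ∑' n, Q.trans (f n) s :=
  lintegral_tsum fun n => ((hf n).comp (measurable_step_left Q s)).aemeasurable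

theorem trans_const (c : ℝ≥0∞) (s : State) : Q.trans (fun _ => c) s = c := by
  simp [Model.trans]

/-- The path of the process from an arbitrary state. -/
noncomputable def Model.path (Q : Model) (s : State) (w : Sample) : ℕ → State
  | 0 => s
  | m + 1 => Q.step (w m) (Q.path s w m)

theorem state_eq_path (k : ℕ) (w : Sample) (m : ℕ) : Q.state k w m = Q.path (.idle k) w m := by
  induction m with
  | zero => rfl
  | succ m ih => simp only [Model.state, Model.path, ih]

/-- Put a draw in front of a sequence of draws. -/
def consSample (u : Source → ℝ) (w : Sample) : Sample
  | 0 => u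
  | n + 1 => w n

theorem path_consSample (s : State) (u : Source → ℝ) (w : Sample) (m : ℕ) :
    Q.path s (consSample u w) (m + 1) = Q.path (Q.step u s) w m := by
  induction m with
  | zero => rfl
  | succ m ih =>
    rw [Model.path, ih]
    rfl

theorem measurable_path (m : ℕ) : Measurable fun q : State × Sample => Q.path q.1 q.2 m := by
  induction m with
  | zero => exact measurable_fst
  | succ m ih =>
    exact (measurable_step Q).comp (ih.prodMk ((measurable_pi_apply m).comp measurable_snd))

theorem measurable_consSample :
    Measurable fun q : (Source → ℝ) × Sample => consSample q.1 q.2 := by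
  refine measurable_pi_iff.2 fun n => ?_
  cases n with
  | zero => exact measurable_fst
  | succ n => exact (measurable_pi_apply n).comp measurable_snd

/-- The draws are i.i.d., so a fresh draw in front of the sequence does not change its law. All
first-step decompositions rest on this. -/
theorem map_consSample :
    (Q.draw.prod Q.prob).map (fun q => consSample q.1 q.2) = Q.prob := by
  classical
  refine Measure.eq_infinitePi _ fun s t ht => ?_
  obtain ⟨N, hN⟩ : ∃ N, s ⊆ Finset.range (N + 1) := by
    obtain ⟨N, hN⟩ := s.exists_nat_subset_range
    exact ⟨N, hN.trans (Finset.range_mono (Nat.le_succ N))⟩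
  -- Padding with the whole space makes the index set an initial segment, from which coordinate 0
  -- splits off.
  set t' : ℕ → Set (Source → ℝ) := fun n => if n ∈ s then t n else Set.univ with ht'
  have ht'm : ∀ n, MeasurableSet (t' n) := by
    intro n
    simp only [ht']
    split_ifs
    · exact ht n
    · exact .univ
  have hset : (s : Set ℕ).pi t = ((Finset.range (N + 1) : Finset ℕ) : Set ℕ).pi t' := by
    ext w
    simp only [Set.mem_pi, Finset.mem_coe, ht']
    constructor
    · intro h n _
      split_ifs with hn
      · exact h n hn
      · trivial
    · intro h n hn
      have := h n (hN hn)
      rwa [if_pos hn] at this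
  have hprod : ∏ i ∈ s, Q.draw (t i) = ∏ i ∈ Finset.range (N + 1), Q.draw (t' i) := by
    rw [← Finset.prod_subset hN]
    · refine Finset.prod_congr rfl fun i hi => ?_
      simp [ht', hi]
    · intro i _ hi
      simp [ht', hi]
  have hpre : (fun q : (Source → ℝ) × Sample => consSample q.1 q.2) ⁻¹'
      ((Finset.range (N + 1) : Finset ℕ) : Set ℕ).pi t' =
      t' 0 ×ˢ ((Finset.range N : Finset ℕ) : Set ℕ).pi fun n => t' (n + 1) := by
    ext ⟨u, w⟩
    simp only [Set.mem_preimage, Set.mem_pi, Finset.coe_range, Set.mem_Iio, Set.mem_prod]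
    constructor
    · intro h
      exact ⟨h 0 (by omega), fun n hn => h (n + 1) (by omega)⟩
    · rintro ⟨h0, h1⟩ n hn
      cases n with
      | zero => exact h0
      | succ n => exact h1 n (by omega)
  rw [hset, hprod, Measure.map_apply measurable_consSample
    (MeasurableSet.pi (Set.to_countable _) fun n _ => ht'm n), hpre, Measure.prod_prod,
    Finset.prod_range_succ', mul_comm]
  congr 1
  unfold Model.prob
  rw [Measure.infinitePi_pi _ fun i _ => ht'm (i + 1)]

theorem lintegral_prob_eq {F : Sample → ℝ≥0∞} (hF : Measurable F) :
    ∫⁻ w, F w ∂Q.prob = ∫⁻ u, ∫⁻ w, F (consSample u w) ∂Q.prob ∂Q.draw := by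
  conv_lhs => rw [← map_consSample Q]
  rw [lintegral_map hF measurable_consSample,
    lintegral_prod (fun q : (Source → ℝ) × Sample => F (consSample q.1 q.2))
      (hF.comp measurable_consSample).aemeasurable]

theorem prob_eq_lintegral {A : Set Sample} (hA : MeasurableSet A) :
    Q.prob A = ∫⁻ u, Q.prob {w | consSample u w ∈ A} ∂Q.draw := by
  rw [← lintegral_indicator_one hA, lintegral_prob_eq Q (measurable_one.indicator hA)]
  refine lintegral_congr fun u => ?_
  have hm : Measurable (consSample u) :=
    measurable_consSample.comp (measurable_const.prodMk measurable_id)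
  rw [show {w | consSample u w ∈ A} = consSample u ⁻¹' A from rfl,
    ← lintegral_indicator_one (hm hA)]
  rfl

end RetrialQueue

/-! ### The comparison principle and the Markov property of the embedded chain -/

namespace RetrialQueue

variable (Q : Model)

/-- The probability that the server is not idle during the first `n` transitions. -/
noncomputable def Model.stay (Q : Model) : ℕ → State → ℝ≥0∞
  | 0 => Set.indicator {s | ¬ s.IsIdle} 1
  | n + 1 => Set.indicator {s | ¬ s.IsIdle} (Q.trans (Q.stay n))

/-- Services are completed almost surely. -/
def Model.Terminates : Prop := ∀ s, Tendsto (fun n => Q.stay n s) atTop (nhds 0)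

theorem measurable_stay (n : ℕ) : Measurable (Q.stay n) := by
  induction n with
  | zero => exact measurable_one.indicator measurableSet_isIdle.compl
  | succ n ih => exact (measurable_trans Q ih).indicator measurableSet_isIdle.compl

variable {Q}

/-- A subsolution of the one-step equation is dominated by a supersolution that dominates it in the
idle states, if their difference is bounded. -/
theorem Model.Terminates.le_of_subsolution (hQ : Q.Terminates) {f F : State → ℝ≥0∞}
    (hF : Measurable F) (S : Set State) (hS : ∀ s ∈ S, ¬ s.IsIdle → ∀ u, Q.step u s ∈ S)
    (hf_step : ∀ s ∈ S, ¬ s.IsIdle → f s ≤ Q.trans f s)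
    (hF_step : ∀ s ∈ S, ¬ s.IsIdle → Q.trans F s ≤ F s)
    (hidle : ∀ k, f (.idle k) ≤ F (.idle k)) {C : ℝ≥0∞} (hC : C ≠ ∞)
    (hbound : ∀ s ∈ S, ¬ s.IsIdle → f s ≤ F s + C) {s : State} (hs : s ∈ S) : f s ≤ F s := by
  have hidle' : ∀ s : State, s.IsIdle → f s ≤ F s := by
    intro s h
    cases s with
    | idle k => exact hidle k
    | busy => exact h.elim
    | failed => exact h.elim
  -- Iterating the one-step inequalities confines the error `C` to the event that no idle state has
  -- been met yet. Its probability tends to 0 by termination.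
  have key : ∀ n, ∀ s ∈ S, f s ≤ F s + C * Q.stay n s := by
    intro n
    induction n with
    | zero =>
      intro s hs
      by_cases h : s.IsIdle
      · exact (hidle' s h).trans le_self_add
      · simpa [Model.stay, h] using hbound s hs h
    | succ n ih =>
      intro s hs
      by_cases h : s.IsIdle
      · exact (hidle' s h).trans le_self_add
      · calc f s ≤ Q.trans f s := hf_step s hs h
          _ ≤ Q.trans (fun s => F s + C * Q.stay n s) s :=
            trans_mono Q fun u => ih _ (hS s hs h u)
          _ = Q.trans F s + C * Q.trans (Q.stay n) s := by
            rw [trans_add Q hF, trans_const_mul Q (measurable_stay Q n)]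
          _ ≤ F s + C * Q.stay (n + 1) s := by
            gcongr
            · exact hF_step s hs h
            · simp [Model.stay, h]
  refine ge_of_tendsto' (x := atTop) (f := fun n => F s + C * Q.stay n s) ?_ fun n => key n s hs
  have := (ENNReal.Tendsto.const_mul (hQ s) (.inr hC)).const_add (F s)
  simpa using this

variable (Q)

/-- The number of calls in orbit at the `n`-th visit to an idle state, for the process that starts
from an arbitrary state. -/
noncomputable def Model.emb (s : State) (n : ℕ) (w : Sample) : ℕ :=
  (Q.path s w (Nat.nth (fun m => (Q.path s w m).IsIdle) n)).orbit

theorem embedded_eq_emb (k n : ℕ) (w : Sample) : Q.embedded k n w = Q.emb (.idle k) n w := by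
  simp only [Model.embedded, Model.emb, state_eq_path]

theorem measurable_emb (n : ℕ) : Measurable fun q : State × Sample => Q.emb q.1 n q.2 := by
  refine measurable_orbit.comp ?_
  have h1 : Measurable fun r : ℕ × State × Sample => Q.path r.2.1 r.2.2 r.1 :=
    measurable_from_prod_countable_right fun m => measurable_path Q m
  have h2 : Measurable fun q : State × Sample =>
      Nat.nth (fun m => (Q.path q.1 q.2 m).IsIdle) n :=
    measurable_nat_nth (fun m => measurable_path Q m measurableSet_isIdle) n
  exact h1.comp (h2.prodMk measurable_id)

theorem measurable_emb_right (s : State) (n : ℕ) : Measurable (Q.emb s n) :=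
  (measurable_emb Q n).comp (measurable_const.prodMk measurable_id)

variable {Q}

theorem emb_consSample_of_not_isIdle {s : State} (hs : ¬ s.IsIdle) (n : ℕ) (u : Source → ℝ)
    {w : Sample} (hw : {m | (Q.path (Q.step u s) w m).IsIdle}.Infinite) :
    Q.emb s n (consSample u w) = Q.emb (Q.step u s) n w := by
  unfold Model.emb
  rw [Nat.nth_eq_of_infinite_of_not (by simpa only [path_consSample] using hw) hs]
  simp only [path_consSample]

theorem emb_zero_of_idle (k : ℕ) (w : Sample) : Q.emb (.idle k) 0 w = k := by
  unfold Model.emb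
  rw [Nat.nth_zero_eq_zero]
  · rfl
  · trivial

theorem emb_succ_consSample_of_idle (k n : ℕ) (u : Source → ℝ)
    {w : Sample} (hw : {m | (Q.path (Q.step u (.idle k)) w m).IsIdle}.Infinite) :
    Q.emb (.idle k) (n + 1) (consSample u w) = Q.emb (Q.step u (.idle k)) n w := by
  unfold Model.emb
  rw [Nat.nth_succ_eq_of_infinite (by simpa only [path_consSample] using hw) trivial]
  simp only [path_consSample]

/-- The probability of never being idle is a bounded subsolution that vanishes at idle states, hence
zero. Conditioning on one draw at a time carries this over to never being idle from time `t` on. -/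
theorem Model.Terminates.ae_frequently_isIdle (hQ : Q.Terminates) (s : State) :
    ∀ᵐ w ∂Q.prob, ∃ᶠ m in atTop, (Q.path s w m).IsIdle := by
  have hmeas : ∀ t, MeasurableSet {q : State × Sample | ∀ m, t ≤ m → ¬ (Q.path q.1 q.2 m).IsIdle} := by
    intro t
    have : {q : State × Sample | ∀ m, t ≤ m → ¬ (Q.path q.1 q.2 m).IsIdle} =
        ⋂ m, ⋂ (_ : t ≤ m), (fun q : State × Sample => Q.path q.1 q.2 m) ⁻¹' {s | s.IsIdle}ᶜ := by
      ext q; simp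
    rw [this]
    exact .iInter fun m => .iInter fun _ => measurable_path Q m measurableSet_isIdle.compl
  set N : ℕ → State → ℝ≥0∞ := fun t s => Q.prob {w | ∀ m, t ≤ m → ¬ (Q.path s w m).IsIdle}
  have hm : ∀ t s, MeasurableSet {w | ∀ m, t ≤ m → ¬ (Q.path s w m).IsIdle} := fun t s =>
    (measurable_const.prodMk measurable_id : Measurable fun w : Sample => (s, w)) (hmeas t)
  have hstep : ∀ t s, N (t + 1) s = Q.trans (N t) s := by
    intro t s
    simp only [N, Model.trans]
    rw [prob_eq_lintegral Q (hm (t + 1) s)]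
    refine lintegral_congr fun u => congrArg _ ?_
    ext w
    simp only [Set.mem_ofPred_eq]
    constructor
    · intro h m hm
      have := h (m + 1) (by omega)
      rwa [path_consSample] at this
    · intro h m hm
      obtain ⟨m, rfl⟩ : ∃ m', m = m' + 1 := ⟨m - 1, by omega⟩
      rw [path_consSample]
      exact h m (by omega)
  have hzero : ∀ s, N 0 s = 0 := by
    intro s
    refine le_antisymm ?_ bot_le
    refine hQ.le_of_subsolution (F := fun _ => 0) measurable_const Set.univ (fun _ _ _ _ => trivial)
      (fun s _ hs => ?_) (fun s _ _ => by simp [Model.trans]) (fun k => ?_) ENNReal.one_ne_top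
      (fun s _ _ => ?_) (Set.mem_univ s)
    · rw [← hstep]
      exact measure_mono fun w hw m hm => hw m (Nat.zero_le m)
    · have : {w | ∀ m, 0 ≤ m → ¬ (Q.path (.idle k) w m).IsIdle} = ∅ :=
        Set.eq_empty_of_forall_notMem fun w hw => hw 0 le_rfl trivial
      simp only [N, this, measure_empty, le_refl]
    · rw [zero_add]
      exact prob_le_one
  have hall : ∀ t s, N t s = 0 := by
    intro t
    induction t with
    | zero => exact hzero
    | succ t ih =>
      intro s
      rw [hstep]
      simp [Model.trans, ih]
  have : ∀ᵐ w ∂Q.prob, ∀ t, ¬ ∀ m, t ≤ m → ¬ (Q.path s w m).IsIdle := by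
    rw [ae_all_iff]
    intro t
    rw [ae_iff]
    simpa using hall t s
  filter_upwards [this] with w hw
  rw [frequently_atTop]
  intro t
  have := hw t
  push Not at this
  exact this

theorem Model.Terminates.ae_infinite (hQ : Q.Terminates) (s : State) :
    ∀ᵐ w ∂Q.prob, {m | (Q.path s w m).IsIdle}.Infinite := by
  filter_upwards [hQ.ae_frequently_isIdle s] with w hw
  exact Nat.frequently_atTop_iff_infinite.1 hw

variable (Q)

/-- The mean of `g` at the orbit size at the first visit to an idle state. -/
noncomputable def Model.hit (g : ℕ → ℝ≥0∞) (s : State) : ℝ≥0∞ := ∫⁻ w, g (Q.emb s 0 w) ∂Q.prob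

theorem measurable_hit (g : ℕ → ℝ≥0∞) : Measurable (Q.hit g) := by
  have : Measurable fun q : State × Sample => g (Q.emb q.1 0 q.2) :=
    measurable_from_nat.comp (measurable_emb Q 0)
  exact this.lintegral_prod_right'

theorem measurable_comp_emb (g : ℕ → ℝ≥0∞) (s : State) : Measurable fun w => g (Q.emb s 0 w) :=
  measurable_from_nat.comp (measurable_emb_right Q s 0)

theorem hit_idle (g : ℕ → ℝ≥0∞) (k : ℕ) : Q.hit g (.idle k) = g k := by
  simp [Model.hit, emb_zero_of_idle]

theorem hit_mono {g h : ℕ → ℝ≥0∞} (hgh : ∀ k, g k ≤ h k) (s : State) : Q.hit g s ≤ Q.hit h s :=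
  lintegral_mono fun _ => hgh _

theorem hit_const (c : ℝ≥0∞) (s : State) : Q.hit (fun _ => c) s = c := by
  simp [Model.hit]

variable {Q}

theorem Model.Terminates.hit_eq_trans (hQ : Q.Terminates) (g : ℕ → ℝ≥0∞) {s : State}
    (hs : ¬ s.IsIdle) : Q.hit g s = Q.trans (Q.hit g) s := by
  unfold Model.hit Model.trans
  rw [lintegral_prob_eq Q (measurable_comp_emb Q g s)]
  refine lintegral_congr fun u => lintegral_congr_ae ?_
  filter_upwards [hQ.ae_infinite (Q.step u s)] with w hw
  rw [emb_consSample_of_not_isIdle hs 0 u hw]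

/-- The hitting mean of a bounded function is the unique bounded solution of the one-step
equation. -/
theorem Model.Terminates.eq_hit_mul (hQ : Q.Terminates) {f : State → ℝ≥0∞} (hf : Measurable f)
    (hf1 : ∀ s, f s ≤ 1) (hf_step : ∀ s : State, ¬ s.IsIdle → f s = Q.trans f s)
    {g : ℕ → ℝ≥0∞} (hg : ∀ k, g k ≤ 1) {c : ℝ≥0∞} (hc : c ≤ 1)
    (hidle : ∀ k, f (.idle k) = g k * c) (s : State) : f s = Q.hit g s * c := by
  have hm := (measurable_hit Q g).mul_const c
  have htrans : ∀ s : State, ¬ s.IsIdle →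
      Q.hit g s * c = Q.trans (fun s => Q.hit g s * c) s := by
    intro s hs
    rw [trans_mul_const Q (measurable_hit Q g), ← hQ.hit_eq_trans g hs]
  have h1 : ∀ s, Q.hit g s * c ≤ 1 := by
    intro s
    refine mul_le_one' ?_ hc
    calc Q.hit g s ≤ Q.hit (fun _ => 1) s := hit_mono Q hg s
      _ = 1 := hit_const Q 1 s
  refine le_antisymm ?_ ?_
  · exact hQ.le_of_subsolution hm Set.univ (fun _ _ _ _ => trivial)
      (fun s _ hs => (hf_step s hs).le) (fun s _ hs => (htrans s hs).ge)
      (fun k => by rw [hit_idle, hidle]) ENNReal.one_ne_top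
      (fun s _ _ => (hf1 s).trans le_add_self) (Set.mem_univ s)
  · exact hQ.le_of_subsolution (f := fun s => Q.hit g s * c) hf Set.univ (fun _ _ _ _ => trivial)
      (fun s _ hs => (htrans s hs).le) (fun s _ hs => (hf_step s hs).ge)
      (fun k => by rw [hit_idle, hidle]) ENNReal.one_ne_top
      (fun s _ _ => (h1 s).trans le_add_self) (Set.mem_univ s)

variable (Q)

/-- The indicator function of a point. -/
noncomputable def pointIndicator (j : ℕ) : ℕ → ℝ≥0∞ := Set.indicator {j} 1

/-- The transition matrix of the embedded chain. -/
noncomputable def Model.kernel (k j : ℕ) : ℝ≥0∞ := Q.trans (Q.hit (pointIndicator j)) (.idle k)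

theorem tsum_kernel_mul (k : ℕ) (g : ℕ → ℝ≥0∞) :
    ∑' j, Q.kernel k j * g j = Q.trans (Q.hit g) (.idle k) := by
  have hg : ∀ m, g m = ∑' j, pointIndicator j m * g j := by
    intro m
    rw [tsum_eq_single m]
    · simp [pointIndicator]
    · intro j hj
      simp [pointIndicator, hj.symm]
  have hhit : Q.hit g = fun s => ∑' j, Q.hit (pointIndicator j) s * g j := by
    funext s
    unfold Model.hit
    rw [lintegral_congr fun w => hg (Q.emb s 0 w), lintegral_tsum fun j =>
      ((measurable_comp_emb Q (pointIndicator j) s).mul_const (g j)).aemeasurable]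
    refine tsum_congr fun j => ?_
    rw [lintegral_mul_const _ (measurable_comp_emb Q _ s)]
  rw [hhit, trans_tsum Q fun j => (measurable_hit Q _).mul_const _]
  refine tsum_congr fun j => ?_
  rw [trans_mul_const Q (measurable_hit Q _)]
  rfl

theorem tsum_kernel (k : ℕ) : ∑' j, Q.kernel k j = 1 := by
  have := tsum_kernel_mul Q k fun _ => 1
  simp only [mul_one] at this
  rw [this]
  simp [Model.trans, hit_const]

/-- The probability that the embedded process follows the path `x` up to time `n`. -/
noncomputable def Model.follow (n : ℕ) (x : ℕ → ℕ) (s : State) : ℝ≥0∞ :=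
  Q.prob {w | ∀ m ≤ n, Q.emb s m w = x m}

theorem measurableSet_follow (n : ℕ) (x : ℕ → ℕ) :
    MeasurableSet {q : State × Sample | ∀ m ≤ n, Q.emb q.1 m q.2 = x m} := by
  have : {q : State × Sample | ∀ m ≤ n, Q.emb q.1 m q.2 = x m} =
      ⋂ m, ⋂ (_ : m ≤ n), (fun q : State × Sample => Q.emb q.1 m q.2) ⁻¹' {x m} := by
    ext q; simp
  rw [this]
  exact .iInter fun m => .iInter fun _ => measurable_emb Q m (measurableSet_singleton _)

theorem measurableSet_follow_right (n : ℕ) (x : ℕ → ℕ) (s : State) :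
    MeasurableSet {w | ∀ m ≤ n, Q.emb s m w = x m} :=
  (measurable_const.prodMk measurable_id : Measurable fun w : Sample => (s, w))
    (measurableSet_follow Q n x)

theorem measurable_follow (n : ℕ) (x : ℕ → ℕ) : Measurable (Q.follow n x) :=
  measurable_measure_prodMk_left (measurableSet_follow Q n x)

variable {Q}

theorem Model.Terminates.follow_eq_trans (hQ : Q.Terminates) (n : ℕ) (x : ℕ → ℕ) {s : State}
    (hs : ¬ s.IsIdle) : Q.follow n x s = Q.trans (Q.follow n x) s := by
  unfold Model.follow Model.trans
  rw [prob_eq_lintegral Q (measurableSet_follow_right Q n x s)]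
  refine lintegral_congr fun u => measure_congr ?_
  filter_upwards [hQ.ae_infinite (Q.step u s)] with w hw
  refine propext (forall₂_congr fun m _ => ?_)
  rw [emb_consSample_of_not_isIdle hs m u hw]

theorem follow_idle_of_ne (n : ℕ) {x : ℕ → ℕ} {k : ℕ} (hk : x 0 ≠ k) :
    Q.follow n x (.idle k) = 0 := by
  have : {w | ∀ m ≤ n, Q.emb (.idle k) m w = x m} = ∅ :=
    Set.eq_empty_of_forall_notMem fun w hw => hk (by rw [← hw 0 (Nat.zero_le n), emb_zero_of_idle])
  simp [Model.follow, this]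

theorem Model.Terminates.follow_succ_idle (hQ : Q.Terminates) (n : ℕ) (x : ℕ → ℕ) :
    Q.follow (n + 1) x (.idle (x 0)) = Q.trans (Q.follow n fun m => x (m + 1)) (.idle (x 0)) := by
  unfold Model.follow Model.trans
  rw [prob_eq_lintegral Q (measurableSet_follow_right Q (n + 1) x _)]
  refine lintegral_congr fun u => measure_congr ?_
  filter_upwards [hQ.ae_infinite (Q.step u (.idle (x 0)))] with w hw
  refine propext ?_
  constructor
  · intro h m hm
    rw [← emb_succ_consSample_of_idle _ m u hw]
    exact h (m + 1) (by omega)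
  · intro h m hm
    cases m with
    | zero => exact emb_zero_of_idle _ _
    | succ m =>
      rw [emb_succ_consSample_of_idle _ m u hw]
      exact h m (by omega)

/-- The strong Markov property at the first idle time: both sides are bounded solutions of the
one-step equation with the same values at the idle states. -/
theorem Model.Terminates.follow_eq_hit_mul (hQ : Q.Terminates) (n : ℕ) (x : ℕ → ℕ) (s : State) :
    Q.follow n x s = Q.hit (pointIndicator (x 0)) s * Q.follow n x (.idle (x 0)) := by
  refine hQ.eq_hit_mul (measurable_follow Q n x) (fun _ => prob_le_one)
    (fun s hs => hQ.follow_eq_trans n x hs) (fun k => ?_) prob_le_one (fun k => ?_) s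
  · exact Set.indicator_le_self' (fun _ _ => zero_le) k
  · by_cases hk : x 0 = k
    · subst hk
      simp [pointIndicator, Model.follow]
    · rw [follow_idle_of_ne n hk]
      simp [pointIndicator, Ne.symm hk]

/-- The first transition leaves the idle state; the strong Markov property at the next idle time
then splits off one factor of the kernel. -/
theorem Model.Terminates.follow_idle (hQ : Q.Terminates) (n : ℕ) : ∀ x : ℕ → ℕ,
    Q.follow n x (.idle (x 0)) = ∏ m ∈ Finset.range n, Q.kernel (x m) (x (m + 1)) := by
  induction n with
  | zero =>
    intro x
    have : {w | ∀ m ≤ 0, Q.emb (.idle (x 0)) m w = x m} = Set.univ := by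
      refine Set.eq_univ_of_forall fun w m hm => ?_
      rw [Nat.le_zero.1 hm, emb_zero_of_idle]
    rw [Model.follow, this, measure_univ, Finset.range_zero, Finset.prod_empty]
  | succ n ih =>
    intro x
    rw [hQ.follow_succ_idle, Finset.prod_range_succ', mul_comm, ← ih fun m => x (m + 1)]
    have : Q.follow n (fun m => x (m + 1)) = fun s => Q.hit (pointIndicator (x 1)) s *
        Q.follow n (fun m => x (m + 1)) (.idle (x 1)) :=
      funext fun s => hQ.follow_eq_hit_mul n _ s
    rw [this, trans_mul_const Q (measurable_hit Q _)]
    congr 1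
    exact congrFun this _

theorem Model.Terminates.measure_cylinder (hQ : Q.Terminates) (i n : ℕ) (x : ℕ → ℕ) :
    Q.prob {w | ∀ m ≤ n, Q.embedded i m w = x m} =
      if x 0 = i then ∏ m ∈ Finset.range n, Q.kernel (x m) (x (m + 1)) else 0 := by
  simp only [embedded_eq_emb]
  change Q.follow n x (.idle i) = _
  split_ifs with h
  · subst h
    exact hQ.follow_idle n x
  · exact follow_idle_of_ne n h

theorem measurable_embedded (i n : ℕ) : Measurable (Q.embedded i n) := by
  have : Q.embedded i n = Q.emb (.idle i) n := funext fun w => embedded_eq_emb Q i n w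
  rw [this]
  exact measurable_emb_right Q _ n

end RetrialQueue

/-! ### Exponential clocks and redrawing a single source -/

namespace RetrialQueue

theorem expMeasure_Iic {a : ℝ} (ha : 0 ≤ a) :
    expMeasure 1 (Set.Iic a) = ENNReal.ofReal (1 - Real.exp (-a)) := by
  rw [← ofReal_cdf, cdf_expMeasure_eq one_pos, if_pos ha, one_mul]

theorem expMeasure_Ioi {a : ℝ} (ha : 0 ≤ a) :
    expMeasure 1 (Set.Ioi a) = ENNReal.ofReal (Real.exp (-a)) := by
  rw [← Set.compl_Iic, prob_compl_eq_one_sub measurableSet_Iic, expMeasure_Iic ha,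
    ← ENNReal.ofReal_one, ← ENNReal.ofReal_sub _ (by simpa using ha)]
  congr 1
  ring

theorem expMeasure_absolutelyContinuous : expMeasure 1 ≪ volume :=
  withDensity_absolutelyContinuous _ _

theorem expMeasure_singleton (a : ℝ) : expMeasure 1 {a} = 0 :=
  expMeasure_absolutelyContinuous Real.volume_singleton

theorem ae_expMeasure_pos : ∀ᵐ e ∂expMeasure 1, 0 < e := by
  rw [ae_iff]
  have : {a : ℝ | ¬ 0 < a} = Set.Iic 0 := by ext; simp
  rw [this, expMeasure_Iic le_rfl]
  simp

theorem expMeasure_Ioi_ne_zero (a : ℝ) : expMeasure 1 (Set.Ioi a) ≠ 0 := by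
  have h : expMeasure 1 (Set.Ioi (max a 0)) ≤ expMeasure 1 (Set.Ioi a) :=
    measure_mono (Set.Ioi_subset_Ioi (le_max_left _ _))
  rw [expMeasure_Ioi (le_max_right _ _)] at h
  exact ((ENNReal.ofReal_pos.2 (Real.exp_pos _)).trans_le h).ne'

theorem expMeasure_Iio_ne_zero {a : ℝ} (ha : 0 < a) : expMeasure 1 (Set.Iio a) ≠ 0 := by
  have h : expMeasure 1 (Set.Iic (a / 2)) ≤ expMeasure 1 (Set.Iio a) :=
    measure_mono (Set.Iic_subset_Iio.2 (by linarith))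
  rw [expMeasure_Iic (by linarith)] at h
  refine (lt_of_lt_of_le (ENNReal.ofReal_pos.2 ?_) h).ne'
  have : Real.exp (-(a / 2)) < 1 := by
    rw [← Real.exp_zero]
    exact Real.exp_lt_exp.2 (by linarith)
  linarith

theorem clock_eq_ofReal {q : ℝ} (hq : 0 < q) (e : ℝ) : clock q e = ENNReal.ofReal (e / q) := by
  rw [clock, ENNReal.ofReal_div_of_pos hq]

theorem clock_zero {e : ℝ} (he : 0 < e) : clock 0 e = ∞ := by
  simp [clock, ENNReal.div_zero, he]

theorem clock_lt {q e x : ℝ} (hx : 0 < x) (hq : 0 < q) (h : e < q * x) :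
    clock q e < ENNReal.ofReal x := by
  rw [clock_eq_ofReal hq, ENNReal.ofReal_lt_ofReal_iff hx, div_lt_iff₀ hq]
  linarith

theorem le_clock {q e x : ℝ} (hq : 0 ≤ q) (he : 0 < e) (h : q * x ≤ e) :
    ENNReal.ofReal x ≤ clock q e := by
  rcases hq.eq_or_lt with rfl | hq
  · rw [clock_zero he]
    exact le_top
  · rw [clock_eq_ofReal hq]
    refine ENNReal.ofReal_le_ofReal ?_
    rw [le_div_iff₀ hq]
    linarith

/-- The probability that a clock rings by the time `z` is its rate times its mean running time. -/
theorem expMeasure_clock_le {q : ℝ} (hq : 0 ≤ q) {z : ℝ≥0∞} (hz : z ≠ ∞) :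
    expMeasure 1 {e | clock q e ≤ z} =
      ENNReal.ofReal q * ∫⁻ e, min (clock q e) z ∂expMeasure 1 := by
  -- A clock of rate 0 is almost surely infinite, so it does not ring by the finite time `z`. For `z
  -- = ∞` the identity would fail here.
  rcases hq.eq_or_lt with rfl | hq
  · rw [ENNReal.ofReal_zero, zero_mul]
    refine measure_mono_null (fun e he => ?_) (ae_iff.1 ae_expMeasure_pos)
    intro hpos
    have he' : clock 0 e ≤ z := he
    rw [clock_zero hpos, top_le_iff] at he'
    exact hz he'
  · set t := z.toReal with ht
    have ht0 : 0 ≤ t := ENNReal.toReal_nonneg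
    have hzt : z = ENNReal.ofReal t := (ENNReal.ofReal_toReal hz).symm
    have h1 : {e | clock q e ≤ z} = Set.Iic (q * t) := by
      ext e
      simp only [Set.mem_ofPred_eq, Set.mem_Iic]
      rw [clock_eq_ofReal hq, hzt, ENNReal.ofReal_le_ofReal_iff ht0, div_le_iff₀ hq, mul_comm]
    rw [h1, expMeasure_Iic (by positivity)]
    have h2 : ∫⁻ e, min (clock q e) z ∂expMeasure 1 =
        ∫⁻ e, ENNReal.ofReal (min (e / q) t) ∂expMeasure 1 := by
      refine lintegral_congr fun e => ?_
      rw [clock_eq_ofReal hq, hzt]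
      exact (ENNReal.ofReal_min _ _).symm
    have h3 : 0 ≤ᵐ[expMeasure 1] fun e => min (e / q) t := by
      filter_upwards [ae_expMeasure_pos] with e he
      exact le_min (by positivity) ht0
    -- Layer cake: the mean of min(e/q, t) is ∫₀ᵗ exp(-qs) ds, and q exp(-qs) is the exponential
    -- density.
    rw [h2, lintegral_eq_lintegral_meas_lt _ h3 (by fun_prop)]
    have h4 : ∀ s ∈ Set.Ioi (0 : ℝ), expMeasure 1 {e | s < min (e / q) t} =
        Set.indicator (Set.Iio t) (fun s => ENNReal.ofReal (Real.exp (-(q * s)))) s := by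
      intro s hs
      have hs' : 0 < s := hs
      by_cases hst : s < t
      · rw [Set.indicator_of_mem (Set.mem_Iio.2 hst), ← expMeasure_Ioi (by positivity)]
        congr 1
        ext e
        simp only [Set.mem_ofPred_eq, lt_min_iff, Set.mem_Ioi]
        rw [lt_div_iff₀ hq, mul_comm]
        simp [hst]
      · rw [Set.indicator_of_notMem (by simpa using hst)]
        have : {e : ℝ | s < min (e / q) t} = ∅ := by
          ext e
          simp [hst]
        rw [this, measure_empty]
    rw [setLIntegral_congr_fun measurableSet_Ioi h4, setLIntegral_indicator measurableSet_Iio,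
      ← lintegral_const_mul _ (by fun_prop)]
    have h5 : ∫⁻ s in Set.Iio t ∩ Set.Ioi 0, ENNReal.ofReal q * ENNReal.ofReal (Real.exp (-(q * s))) =
        ∫⁻ s in Set.Iio t ∩ Set.Ioi 0, exponentialPDF q s := by
      refine setLIntegral_congr_fun (measurableSet_Iio.inter measurableSet_Ioi) fun s hs => ?_
      rw [exponentialPDF_of_nonneg (le_of_lt hs.2), ENNReal.ofReal_mul hq.le]
    have h6 : ∫⁻ s in Set.Iio t ∩ Set.Ioi 0, exponentialPDF q s =
        ∫⁻ s in Set.Iic t, exponentialPDF q s := by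
      have h7 : ∫⁻ s in Set.Iic t, exponentialPDF q s = ∫⁻ s in Set.Iio t, exponentialPDF q s :=
        setLIntegral_congr Iio_ae_eq_Iic.symm
      have h8 : ∫⁻ s in Set.Iio t \ Set.Ioi 0, exponentialPDF q s = 0 := by
        have h9 : Set.Iio t \ Set.Ioi 0 ⊆ Set.Iic 0 := fun s hs =>
            Set.mem_Iic.2 (not_lt.1 fun h => hs.2 (Set.mem_Ioi.2 h))
        refine le_antisymm ((lintegral_mono_set h9).trans ?_) bot_le
        rw [← setLIntegral_congr Iio_ae_eq_Iic, lintegral_exponentialPDF_of_nonpos le_rfl]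
      rw [h7, ← lintegral_inter_add_sdiff (μ := volume) (exponentialPDF q) (Set.Iio t)
        (measurableSet_Ioi (a := (0 : ℝ))), h8, add_zero]
    rw [h5, h6, lintegral_exponentialPDF_eq_antiDeriv hq, if_pos ht0]

/-- Ties are null: for positive rate they fix a single value of `e`, and for rate 0 the clock is
almost surely infinite. -/
theorem expMeasure_clock_lt {q : ℝ} (hq : 0 ≤ q) {z : ℝ≥0∞} (hz : z ≠ ∞) :
    expMeasure 1 {e | clock q e < z} =
      ENNReal.ofReal q * ∫⁻ e, min (clock q e) z ∂expMeasure 1 := by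
  rw [← expMeasure_clock_le hq hz]
  refine measure_congr ?_
  have hne : ∀ᵐ e ∂expMeasure 1, e ≠ q * z.toReal := by
    rw [ae_iff]
    simpa using expMeasure_singleton (q * z.toReal)
  filter_upwards [ae_expMeasure_pos, hne] with e he hez
  refine propext ⟨fun h : clock q e < z => h.le, fun h : clock q e ≤ z => lt_of_le_of_ne h ?_⟩
  intro heq
  rcases hq.eq_or_lt with rfl | hq
  · rw [clock_zero he] at heq
    exact hz heq.symm
  · rw [clock_eq_ofReal hq] at heq
    refine hez ?_
    rw [← heq, ENNReal.toReal_ofReal (by positivity)]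
    field_simp

variable (Q : Model)

theorem measurable_update' (s : Source) :
    Measurable fun q : (Source → ℝ) × ℝ => Function.update q.1 s q.2 := by
  refine measurable_pi_iff.2 fun r => ?_
  by_cases h : r = s
  · subst h
    simpa using measurable_snd
  · simp only [Function.update_of_ne h]
    exact (measurable_pi_apply r).comp measurable_fst

/-- Replacing one coordinate by an independent copy preserves a product law. This serves as
conditioning on all other sources. -/
theorem map_update (s : Source) :
    (Q.draw.prod (Q.law s)).map (fun q => Function.update q.1 s q.2) = Q.draw := by
  refine (Measure.pi_eq fun t ht => ?_).symm
  have hpre : (fun q : (Source → ℝ) × ℝ => Function.update q.1 s q.2) ⁻¹' Set.univ.pi t =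
      (Set.univ.pi (Function.update t s Set.univ)) ×ˢ t s := by
    ext ⟨u, e⟩
    simp only [Set.mem_preimage, Set.mem_pi, Set.mem_univ, true_imp_iff, Set.mem_prod]
    constructor
    · intro h
      refine ⟨fun r => ?_, by simpa using h s⟩
      by_cases hr : r = s
      · subst hr; simp
      · simpa [Function.update_of_ne hr] using h r
    · rintro ⟨h1, h2⟩ r
      by_cases hr : r = s
      · subst hr; simpa using h2
      · simpa [Function.update_of_ne hr] using h1 r
  rw [Measure.map_apply (measurable_update' s) (MeasurableSet.univ_pi ht), hpre, Measure.prod_prod,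
    Measure.pi_pi, ← Finset.mul_prod_erase _ _ (Finset.mem_univ s),
    ← Finset.mul_prod_erase Finset.univ (fun i => Q.law i (t i)) (Finset.mem_univ s)]
  simp only [Function.update_self, measure_univ, one_mul]
  rw [mul_comm]
  congr 1
  refine Finset.prod_congr rfl fun r hr => ?_
  rw [Function.update_of_ne (Finset.ne_of_mem_erase hr)]

/-- A single source may be drawn anew. -/
theorem lintegral_draw_eq (s : Source) {f : (Source → ℝ) → ℝ≥0∞} (hf : Measurable f) :
    ∫⁻ u, f u ∂Q.draw = ∫⁻ u, ∫⁻ e, f (Function.update u s e) ∂Q.law s ∂Q.draw := by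
  conv_lhs => rw [← map_update Q s]
  rw [lintegral_map hf (measurable_update' s),
    lintegral_prod (fun q : (Source → ℝ) × ℝ => f (Function.update q.1 s q.2))
      (hf.comp (measurable_update' s)).aemeasurable]

/-- Independence of the source `s` from an event that does not look at it: redraw `s` and integrate
it out first. -/
theorem lintegral_draw_indicator (s : Source) {E : Set (Source → ℝ)} (hE : MeasurableSet E)
    (hEs : ∀ u e, Function.update u s e ∈ E ↔ u ∈ E) {g : ℝ → ℝ≥0∞} (hg : Measurable g) :
    ∫⁻ u, E.indicator (fun u => g (u s)) u ∂Q.draw = Q.draw E * ∫⁻ e, g e ∂Q.law s := by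
  have hgs : Measurable fun u : Source → ℝ => g (u s) := hg.comp (measurable_pi_apply s)
  rw [lintegral_draw_eq Q s (hgs.indicator hE)]
  have : ∀ u, ∫⁻ e, E.indicator (fun u => g (u s)) (Function.update u s e) ∂Q.law s =
      E.indicator (fun _ => ∫⁻ e, g e ∂Q.law s) u := by
    intro u
    by_cases hu : u ∈ E
    · rw [Set.indicator_of_mem hu]
      refine lintegral_congr fun e => ?_
      rw [Set.indicator_of_mem ((hEs u e).2 hu), Function.update_self]
    · rw [Set.indicator_of_notMem hu, lintegral_congr fun e =>
        Set.indicator_of_notMem (fun h => hu ((hEs u e).1 h)) _]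
      simp
  rw [lintegral_congr this, lintegral_indicator_const hE, mul_comm]

theorem lintegral_draw_eval (s : Source) {g : ℝ → ℝ≥0∞} (hg : Measurable g) :
    ∫⁻ u, g (u s) ∂Q.draw = ∫⁻ e, g e ∂Q.law s := by
  have := lintegral_draw_indicator Q s .univ (fun _ _ => Iff.rfl) hg
  simpa using this

theorem ae_draw_eval (s : Source) {p : ℝ → Prop} (h : ∀ᵐ e ∂Q.law s, p e) :
    ∀ᵐ u ∂Q.draw, p (u s) :=
  (Measure.quasiMeasurePreserving_eval Q.law s).ae h

variable {Q}

theorem draw_eq_lintegral (s : Source) {E : Set (Source → ℝ)} (hE : MeasurableSet E) :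
    Q.draw E = ∫⁻ u, Q.law s {e | Function.update u s e ∈ E} ∂Q.draw := by
  rw [← lintegral_indicator_one hE, lintegral_draw_eq Q s (measurable_one.indicator hE)]
  refine lintegral_congr fun u => ?_
  have hm : Measurable fun e : ℝ => Function.update u s e :=
    (measurable_update' s).comp (measurable_const.prodMk measurable_id)
  have hE' : MeasurableSet {e | Function.update u s e ∈ E} := hm hE
  rw [← lintegral_indicator_one hE']
  rfl

/-- With the other sources frozen, `z` is a constant and the identity for a single clock applies;
then integrate over the rest. -/
theorem draw_clock_lt {s : Source} (hs : Q.law s = expMeasure 1) {q : ℝ} (hq : 0 ≤ q)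
    {z : (Source → ℝ) → ℝ≥0∞} (hz : Measurable z)
    (hzs : ∀ u e, z (Function.update u s e) = z u) (hz_top : ∀ u, z u ≠ ∞) :
    Q.draw {u | clock q (u s) < z u} =
      ENNReal.ofReal q * ∫⁻ u, min (clock q (u s)) (z u) ∂Q.draw := by
  have hc : Measurable fun u : Source → ℝ => clock q (u s) :=
    (measurable_clock q).comp (measurable_pi_apply s)
  rw [draw_eq_lintegral s (measurableSet_lt hc hz), lintegral_draw_eq Q s (hc.min hz),
    ← lintegral_const_mul' _ _ ENNReal.ofReal_ne_top]
  refine lintegral_congr fun u => ?_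
  simp only [Set.mem_ofPred_eq, hzs, Function.update_self]
  rw [hs, ← expMeasure_clock_lt hq (hz_top u)]

theorem draw_clock_le {s : Source} (hs : Q.law s = expMeasure 1) {q : ℝ} (hq : 0 ≤ q)
    {z : (Source → ℝ) → ℝ≥0∞} (hz : Measurable z)
    (hzs : ∀ u e, z (Function.update u s e) = z u) (hz_top : ∀ u, z u ≠ ∞) :
    Q.draw {u | clock q (u s) ≤ z u} =
      ENNReal.ofReal q * ∫⁻ u, min (clock q (u s)) (z u) ∂Q.draw := by
  have hc : Measurable fun u : Source → ℝ => clock q (u s) :=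
    (measurable_clock q).comp (measurable_pi_apply s)
  rw [draw_eq_lintegral s (measurableSet_le hc hz), lintegral_draw_eq Q s (hc.min hz),
    ← lintegral_const_mul' _ _ ENNReal.ofReal_ne_top]
  refine lintegral_congr fun u => ?_
  simp only [Set.mem_ofPred_eq, hzs, Function.update_self]
  rw [hs, ← expMeasure_clock_le hq (hz_top u)]

/-- A measurable function is positive in the mean after a transition, if it is positive when all
draws lie in prescribed sets of positive probability. -/
theorem trans_ne_zero {f : State → ℝ≥0∞} (hf : Measurable f) {s : State}
    {t : Source → Set ℝ} (ht : ∀ r, Q.law r (t r) ≠ 0)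
    (h : ∀ u : Source → ℝ, (∀ r, u r ∈ t r) → f (Q.step u s) ≠ 0) : Q.trans f s ≠ 0 := by
  intro h0
  have hm := hf.comp (measurable_step_left Q s)
  have hae := (lintegral_eq_zero_iff hm).1 h0
  have hbox : Q.draw (Set.univ.pi t) ≠ 0 := by
    rw [Measure.pi_pi]
    exact Finset.prod_ne_zero_iff.2 fun r _ => ht r
  refine hbox (measure_mono_null (fun u hu => ?_) (ae_iff.1 hae))
  exact h u fun r => hu r trivial

end RetrialQueue

/-! ### Affine weights, termination, and the mean orbit size after a service -/

namespace RetrialQueue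

/-- A function that is affine in the number of calls in orbit, in the remaining service time, and,
up to the level `M`, in the remaining repair time. -/
noncomputable def Model.weight (Q : Model) (θ b c : ℝ≥0∞) (κ : CallType → ℝ≥0∞) (M : ℝ≥0∞) :
    State → ℝ≥0∞
  | .idle n => θ * n
  | .busy i n x => θ * n + b + κ i * ENNReal.ofReal x
  | .failed i n x y => θ * n + c + κ i * ENNReal.ofReal x +
      ENNReal.ofReal Q.lam * min (ENNReal.ofReal y) M

/-- The mean repair time, truncated at the level `M`. -/
noncomputable def Model.meanRepair (Q : Model) (M : ℝ≥0∞) (i : CallType) : ℝ≥0∞ :=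
  ∫⁻ y, min (ENNReal.ofReal y) M ∂Q.law (.repair i)

/-- The growth rate of `Model.weight` in the remaining service time that makes it harmonic up to
constants. -/
noncomputable def Model.slope (Q : Model) (θ b c M : ℝ≥0∞) (i : CallType) : ℝ≥0∞ :=
  (θ + b) * ENNReal.ofReal Q.lam +
    ENNReal.ofReal (Q.beta i) * (c + ENNReal.ofReal Q.lam * Q.meanRepair M i)

variable {Q : Model}

theorem measurable_weight (θ b c : ℝ≥0∞) (κ : CallType → ℝ≥0∞) (M : ℝ≥0∞) :
    Measurable (Q.weight θ b c κ M) :=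
  measurable_state (fun i n => by simp only [Model.weight]; fun_prop)
    (fun i n => by simp only [Model.weight]; fun_prop)

theorem measurable_clock_eval (q : ℝ) (s : Source) :
    Measurable fun u : Source → ℝ => clock q (u s) :=
  (measurable_clock q).comp (measurable_pi_apply s)

theorem ofReal_sub_toReal {x : ℝ} {a : ℝ≥0∞} :
    ENNReal.ofReal (x - a.toReal) = ENNReal.ofReal x - ENNReal.ofReal a.toReal :=
  ENNReal.ofReal_sub _ ENNReal.toReal_nonneg

theorem min_add_sub_min (a X : ℝ≥0∞) : min a X + (X - min a X) = X :=
  add_tsub_cancel_of_le (min_le_right _ _)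

/-- One transition from a busy state. -/
theorem trans_weight_busy (hlam : 0 < Q.lam) (hbeta : ∀ i, 0 ≤ Q.beta i) (θ b c M : ℝ≥0∞)
    (i : CallType) (n : ℕ) (x : ℝ) :
    Q.trans (Q.weight θ b c (Q.slope θ b c M) M) (.busy i n x) =
      θ * n + Q.slope θ b c M i * ENNReal.ofReal x := by
  set κ := Q.slope θ b c M i with hκ
  set X := ENNReal.ofReal x with hX
  have hXtop : X ≠ ∞ := ENNReal.ofReal_ne_top
  set A : (Source → ℝ) → ℝ≥0∞ := fun u => clock Q.lam (u .arrival) with hA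
  set F : (Source → ℝ) → ℝ≥0∞ := fun u => clock (Q.beta i) (u .failure) with hF
  have hAm : Measurable A := measurable_clock_eval _ _
  have hFm : Measurable F := measurable_clock_eval _ _
  -- The sojourn time in the busy state.
  set m : (Source → ℝ) → ℝ≥0∞ := fun u => min (A u) (min (F u) X) with hm
  have hmm : Measurable m := hAm.min (hFm.min measurable_const)
  set arr : Set (Source → ℝ) := {u | A u ≤ F u ∧ A u < X} with harr
  set fail : Set (Source → ℝ) := {u | F u < min (A u) X} with hfail
  have harrm : MeasurableSet arr :=
    (measurableSet_le hAm hFm).inter (measurableSet_lt hAm measurable_const)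
  have hfailm : MeasurableSet fail := measurableSet_lt hFm (hAm.min measurable_const)
  set g : ℝ → ℝ≥0∞ := fun y => c + ENNReal.ofReal Q.lam * min (ENNReal.ofReal y) M with hg
  have hgm : Measurable g := by fun_prop
  have hpt : ∀ u, Q.weight θ b c (Q.slope θ b c M) M (Q.step u (.busy i n x)) =
      (θ * n + κ * (X - m u)) + (arr.indicator (fun _ => θ + b) u +
        fail.indicator (fun u => g (u (.repair i))) u) := by
    intro u
    change Q.weight θ b c (Q.slope θ b c M) M (if X ≤ A u ∧ X ≤ F u then .idle n
      else if A u ≤ F u then .busy i (n + 1) (x - (A u).toReal)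
      else .failed i n (x - (F u).toReal) (u (.repair i))) = _
    by_cases h1 : X ≤ A u ∧ X ≤ F u
    · have hma : m u = X := by simp only [hm]; rw [min_eq_right h1.2, min_eq_right h1.1]
      have hna : u ∉ arr := fun h => not_lt.2 h1.1 h.2
      have hnf : u ∉ fail := fun h => not_lt.2 h1.2 (lt_min_iff.1 h).2
      rw [if_pos h1, Set.indicator_of_notMem hna, Set.indicator_of_notMem hnf, hma]
      simp [Model.weight]
    · rw [if_neg h1]
      by_cases h2 : A u ≤ F u
      · have hlt : A u < X := by
          by_contra h
          exact h1 ⟨not_lt.1 h, (not_lt.1 h).trans h2⟩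
        have hma : m u = A u := by
          simp only [hm]; rw [min_eq_left (le_min h2 hlt.le)]
        have hya : u ∈ arr := ⟨h2, hlt⟩
        have hnf : u ∉ fail := fun h => not_lt.2 h2 (lt_min_iff.1 h).1
        rw [if_pos h2, Set.indicator_of_mem hya, Set.indicator_of_notMem hnf, hma]
        simp only [Model.weight]
        rw [ofReal_sub_toReal, ENNReal.ofReal_toReal hlt.ne_top, ← hX, ← hκ]
        push_cast
        ring
      · have h2' := not_le.1 h2
        have hlt : F u < X := by
          by_contra h
          exact h1 ⟨(not_lt.1 h).trans h2'.le, not_lt.1 h⟩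
        have hma : m u = F u := by
          simp only [hm]; rw [min_eq_left hlt.le, min_eq_right h2'.le]
        have hna : u ∉ arr := fun h => h2 h.1
        have hyf : u ∈ fail := lt_min h2' hlt
        rw [if_neg h2, Set.indicator_of_notMem hna, Set.indicator_of_mem hyf, hma]
        simp only [Model.weight]
        rw [ofReal_sub_toReal, ENNReal.ofReal_toReal hlt.ne_top, ← hX, ← hκ, hg]
        ring
  -- `arr` lies between the events that the arrival clock rings strictly before, and no later than,
  -- its competitors. Both have probability λ times the mean sojourn time.
  have hParr : Q.draw arr = ENNReal.ofReal Q.lam * ∫⁻ u, m u ∂Q.draw := by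
    have hz : Measurable fun u : Source → ℝ => min (F u) X := hFm.min measurable_const
    have hzs : ∀ u e, min (F (Function.update u .arrival e)) X = min (F u) X := by
      intro u e; simp [hF]
    have hzt : ∀ u, min (F u) X ≠ ∞ := fun u => (min_lt_of_right_lt hXtop.lt_top).ne
    have hlaw : Q.law .arrival = expMeasure 1 := rfl
    refine le_antisymm ?_ ?_
    · refine le_trans (measure_mono ?_) (draw_clock_le hlaw hlam.le hz hzs hzt).le
      exact fun u hu => le_min hu.1 hu.2.le
    · refine (draw_clock_lt hlaw hlam.le hz hzs hzt).ge.trans (measure_mono ?_)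
      exact fun u hu => ⟨(lt_min_iff.1 hu).1.le, (lt_min_iff.1 hu).2⟩
  have hPfail : Q.draw fail = ENNReal.ofReal (Q.beta i) * ∫⁻ u, m u ∂Q.draw := by
    have hz : Measurable fun u : Source → ℝ => min (A u) X := hAm.min measurable_const
    have hzs : ∀ u e, min (A (Function.update u .failure e)) X = min (A u) X := by
      intro u e; simp [hA]
    have hzt : ∀ u, min (A u) X ≠ ∞ := fun u => (min_lt_of_right_lt hXtop.lt_top).ne
    rw [show fail = {u | clock (Q.beta i) (u .failure) < min (A u) X} from rfl,
      draw_clock_lt (s := .failure) rfl (hbeta i) hz hzs hzt]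
    congr 1
    exact lintegral_congr fun u => min_left_comm _ _ _
  have hgi : ∫⁻ y, g y ∂Q.law (.repair i) = c + ENNReal.ofReal Q.lam * Q.meanRepair M i := by
    simp only [hg]
    rw [lintegral_add_left measurable_const, lintegral_const_mul _ (by fun_prop)]
    simp [Model.meanRepair]
  have hXm : ∫⁻ u, m u ∂Q.draw + ∫⁻ u, (X - m u) ∂Q.draw = X := by
    rw [← lintegral_add_left hmm]
    have : ∀ u, m u + (X - m u) = X := fun u =>
      add_tsub_cancel_of_le ((min_le_right _ _).trans (min_le_right _ _))
    simp [this]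
  have hindep : ∀ u e, Function.update u (.repair i) e ∈ fail ↔ u ∈ fail := by
    intro u e; simp [hfail, hA, hF]
  have hfirst : ∫⁻ u, (θ * n + κ * (X - m u)) ∂Q.draw =
      θ * n + κ * ∫⁻ u, (X - m u) ∂Q.draw := by
    rw [lintegral_add_left measurable_const, lintegral_const_mul κ (by fun_prop)]
    simp
  unfold Model.trans
  rw [lintegral_congr hpt, lintegral_add_left (by fun_prop), hfirst,
    lintegral_add_left (measurable_const.indicator harrm), lintegral_indicator_const harrm,
    lintegral_draw_indicator Q _ hfailm hindep hgm, hgi, hParr, hPfail]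
  -- The slope is the mean gain per unit of sojourn time from arrivals and failures, so it exactly
  -- replaces the service time used up.
  calc _ = θ * n + κ * (∫⁻ u, m u ∂Q.draw + ∫⁻ u, (X - m u) ∂Q.draw) := by
        rw [mul_add, hκ]
        conv_rhs => rw [Model.slope]
        rw [show Q.slope θ b c M i = (θ + b) * ENNReal.ofReal Q.lam +
          ENNReal.ofReal (Q.beta i) * (c + ENNReal.ofReal Q.lam * Q.meanRepair M i) from rfl]
        ring
    _ = _ := by rw [hXm]

/-- One transition from a failed state. -/
theorem trans_weight_failed (hlam : 0 < Q.lam) {θ b c : ℝ≥0∞} (h : θ + c = b + 1) (M : ℝ≥0∞)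
    (κ : CallType → ℝ≥0∞) (i : CallType) (n : ℕ) (x y : ℝ) :
    Q.trans (Q.weight θ b c κ M) (.failed i n x y) =
      θ * n + b + κ i * ENNReal.ofReal x + ENNReal.ofReal Q.lam *
        ∫⁻ u, (min (clock Q.lam (u .arrival)) (ENNReal.ofReal y) +
          min (ENNReal.ofReal y - min (clock Q.lam (u .arrival)) (ENNReal.ofReal y)) M) ∂Q.draw := by
  set Y := ENNReal.ofReal y with hY
  have hYtop : Y ≠ ∞ := ENNReal.ofReal_ne_top
  set A : (Source → ℝ) → ℝ≥0∞ := fun u => clock Q.lam (u .arrival) with hA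
  have hAm : Measurable A := measurable_clock_eval _ _
  set arr : Set (Source → ℝ) := {u | A u < Y} with harr
  have harrm : MeasurableSet arr := measurableSet_lt hAm measurable_const
  -- By `h`, an arrival leaves one unit more than a completed repair, apart from the term for
  -- remaining repair time. Its probability, λ times the mean sojourn time, will balance the repair
  -- time used up.
  have hpt : ∀ u, Q.weight θ b c κ M (Q.step u (.failed i n x y)) =
      (θ * n + b + κ i * ENNReal.ofReal x) + (arr.indicator (fun _ => 1) u +
        ENNReal.ofReal Q.lam * min (Y - min (A u) Y) M) := by
    intro u
    change Q.weight θ b c κ M (if Y ≤ A u then .busy i n x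
      else .failed i (n + 1) x (y - (A u).toReal)) = _
    by_cases h1 : Y ≤ A u
    · have hna : u ∉ arr := fun h => not_lt.2 h1 h
      rw [if_pos h1, Set.indicator_of_notMem hna, min_eq_right h1]
      simp [Model.weight]
    · have hlt := not_le.1 h1
      have hya : u ∈ arr := hlt
      rw [if_neg h1, Set.indicator_of_mem hya, min_eq_left hlt.le]
      simp only [Model.weight]
      rw [ofReal_sub_toReal, ENNReal.ofReal_toReal hlt.ne_top, ← hY]
      push_cast
      calc _ = θ * n + (θ + c) + κ i * ENNReal.ofReal x +
            ENNReal.ofReal Q.lam * min (Y - A u) M := by ring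
        _ = _ := by rw [h]; ring
  have hParr : Q.draw arr = ENNReal.ofReal Q.lam * ∫⁻ u, min (A u) Y ∂Q.draw :=
    draw_clock_lt (s := .arrival) rfl hlam.le (z := fun _ => Y) measurable_const
      (fun _ _ => rfl) fun _ => hYtop
  unfold Model.trans
  rw [lintegral_congr hpt, lintegral_add_left measurable_const,
    lintegral_add_left (measurable_const.indicator harrm), lintegral_indicator_const harrm,
    lintegral_const_mul _ (by fun_prop), hParr, one_mul,
    lintegral_add_left (by fun_prop : Measurable fun u => min (A u) Y)]
  simp only [lintegral_const, measure_univ, mul_one]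
  ring

theorem trans_weight_failed_top (hlam : 0 < Q.lam) {θ b c : ℝ≥0∞} (h : θ + c = b + 1)
    (κ : CallType → ℝ≥0∞) (i : CallType) (n : ℕ) (x y : ℝ) :
    Q.trans (Q.weight θ b c κ ∞) (.failed i n x y) =
      θ * n + b + κ i * ENNReal.ofReal x + ENNReal.ofReal Q.lam * ENNReal.ofReal y := by
  rw [trans_weight_failed hlam h]
  simp only [min_top_right, min_add_sub_min, lintegral_const, measure_univ, mul_one]

/-- Truncation preserves the inequality needed for a subsolution: the elapsed repair time plus the
truncated remainder is at least the truncated total. -/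
theorem le_trans_weight_failed (hlam : 0 < Q.lam) {θ b c : ℝ≥0∞} (h : θ + c = b + 1) (M : ℝ≥0∞)
    (κ : CallType → ℝ≥0∞) (i : CallType) (n : ℕ) (x y : ℝ) :
    θ * n + b + κ i * ENNReal.ofReal x + ENNReal.ofReal Q.lam * min (ENNReal.ofReal y) M ≤
      Q.trans (Q.weight θ b c κ M) (.failed i n x y) := by
  rw [trans_weight_failed hlam h]
  gcongr
  calc min (ENNReal.ofReal y) M = ∫⁻ _u, min (ENNReal.ofReal y) M ∂Q.draw := by simp
    _ ≤ _ := by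
      refine lintegral_mono fun u => ?_
      have := min_add_sub_min (clock Q.lam (u .arrival)) (ENNReal.ofReal y)
      rw [← min_add_add_left, this]
      exact min_le_min le_rfl le_add_self

/-- Almost surely, a service is completed after finitely many transitions. -/
theorem terminates (hlam : 0 < Q.lam) (hbeta : ∀ i, 0 ≤ Q.beta i)
    (hrepair : ∀ i, Q.meanRepair ∞ i ≠ ∞) : Q.Terminates := by
  -- With coefficients θ = 0, b = 1, c = 2 the weight loses `b` at a busy state and `c - b` at a
  -- failed one, both equal to 1. It therefore bounds the mean number of transitions before
  -- idleness.
  set κ := Q.slope 0 1 2 ∞ with hκdef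
  have hκ : ∀ i, κ i ≠ ∞ := by
    intro i
    simp only [hκdef, Model.slope]
    finiteness [hrepair i]
  set H := Q.weight 0 1 2 κ ∞ with hH
  have hHtop : ∀ s, H s ≠ ∞ := by
    intro s
    cases s with
    | idle n => simp [hH, Model.weight]
    | busy i n x =>
      simp only [hH, Model.weight]
      finiteness [hκ i]
    | failed i n x y =>
      simp only [hH, Model.weight]
      have := hκ i
      rw [min_top_right]
      finiteness
  have hstep : ∀ s : State, ¬ s.IsIdle → Q.trans H s + 1 ≤ H s := by
    intro s hs
    cases s with
    | idle n => exact (hs trivial).elim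
    | busy i n x =>
      rw [hH, hκdef, trans_weight_busy hlam hbeta]
      simp only [Model.weight]
      exact le_of_eq (by ring)
    | failed i n x y =>
      rw [hH, trans_weight_failed_top hlam (by norm_num)]
      simp only [Model.weight, min_top_right]
      refine le_of_eq ?_
      rw [← one_add_one_eq_two]
      ring
  have hsum : ∀ N s, ∑ n ∈ Finset.range N, Q.stay n s ≤ H s := by
    intro N
    induction N with
    | zero => simp
    | succ N ih =>
      intro s
      by_cases hs : s.IsIdle
      · have : ∀ n, Q.stay n s = 0 := by
          intro n
          cases n <;> simp [Model.stay, hs]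
        simp [this]
      · refine le_trans ?_ (hstep s hs)
        rw [Finset.sum_range_succ']
        refine add_le_add ?_ (by simp [Model.stay, hs])
        calc ∑ n ∈ Finset.range N, Q.stay (n + 1) s
            = ∑ n ∈ Finset.range N, Q.trans (Q.stay n) s := by simp [Model.stay, hs]
          _ = Q.trans (fun s => ∑ n ∈ Finset.range N, Q.stay n s) s := by
            exact (lintegral_finsetSum _ fun n _ =>
              (measurable_stay Q n).comp (measurable_step_left Q s)).symm
          _ ≤ Q.trans H s := trans_mono Q fun u => ih _
  intro s
  refine ENNReal.tendsto_atTop_zero_of_tsum_ne_top (ne_top_of_le_ne_top (hHtop s) ?_)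
  rw [ENNReal.tsum_eq_iSup_nat]
  exact iSup_le fun N => hsum N s

/-- The mean number of calls that arrive per unit of service time, including interruptions. -/
noncomputable def Model.load (Q : Model) (M : ℝ≥0∞) (i : CallType) : ℝ≥0∞ :=
  ENNReal.ofReal Q.lam * (1 + ENNReal.ofReal (Q.beta i) * Q.meanRepair M i)

theorem slope_one (M : ℝ≥0∞) : Q.slope 1 0 0 M = Q.load M := by
  funext i
  simp only [Model.slope, Model.load]
  ring

theorem orbit_le_step {s : State} (hs : ¬ s.IsIdle) (u : Source → ℝ) :
    s.orbit ≤ (Q.step u s).orbit := by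
  cases s with
  | idle => exact (hs trivial).elim
  | busy i n x =>
    unfold Model.step
    simp only
    split_ifs <;> simp [State.orbit]
  | failed i n x y =>
    unfold Model.step
    simp only
    split_ifs <;> simp [State.orbit]

/-- The weight with θ = 1 and b = c = 0 solves the one-step equation. The comparison principle needs
a bounded difference, so the orbit size is first capped at `c`; monotone convergence removes the
cap. -/
theorem hit_id_le (hlam : 0 < Q.lam) (hbeta : ∀ i, 0 ≤ Q.beta i) (hQ : Q.Terminates) (s : State) :
    Q.hit (fun k => k) s ≤ Q.weight 1 0 0 (Q.load ∞) ∞ s := by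
  have htr : ∀ c : ℕ, Q.hit (fun k => ((min k c : ℕ) : ℝ≥0∞)) s ≤ Q.weight 1 0 0 (Q.load ∞) ∞ s := by
    intro c
    refine hQ.le_of_subsolution (measurable_weight _ _ _ _ _) Set.univ (fun _ _ _ _ => trivial)
      (fun s _ hs => (hQ.hit_eq_trans _ hs).le) (fun s _ hs => ?_) (fun k => ?_)
      (ENNReal.natCast_ne_top c) (fun s _ _ => ?_) (Set.mem_univ s)
    · cases s with
      | idle => exact (hs trivial).elim
      | busy i n x =>
        rw [← slope_one, trans_weight_busy hlam hbeta]
        simp [Model.weight]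
      | failed i n x y =>
        rw [trans_weight_failed_top hlam (by norm_num)]
        simp [Model.weight]
    · rw [hit_idle]
      simp [Model.weight]
    · refine le_trans ?_ le_add_self
      refine (hit_mono Q (h := fun _ => (c : ℝ≥0∞)) (fun k => ?_) s).trans (hit_const Q _ s).le
      exact_mod_cast min_le_right k c
  have hsup : ∀ k : ℕ, ⨆ c : ℕ, ((min k c : ℕ) : ℝ≥0∞) = k := by
    intro k
    refine le_antisymm (iSup_le fun c => by exact_mod_cast min_le_left k c) ?_
    exact le_iSup_of_le k (by simp)
  have : Q.hit (fun k => k) s = ⨆ c : ℕ, Q.hit (fun k => ((min k c : ℕ) : ℝ≥0∞)) s := by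
    unfold Model.hit
    rw [← lintegral_iSup]
    · simp only [hsup]
    · exact fun c => measurable_comp_emb Q (fun k => ((min k c : ℕ) : ℝ≥0∞)) s
    · intro c d hcd w
      exact Nat.cast_le.2 (min_le_min le_rfl hcd)
  rw [this]
  exact iSup_le htr

/-- The orbit cannot shrink while the server is not idle. Capping at the initial orbit size makes
the subsolution bounded. -/
theorem orbit_le_hit_id (hQ : Q.Terminates) (s : State) :
    (s.orbit : ℝ≥0∞) ≤ Q.hit (fun k => k) s := by
  refine hQ.le_of_subsolution (f := fun s => min (s.orbit : ℝ≥0∞) (State.orbit _))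
    (measurable_hit Q _) Set.univ (fun _ _ _ _ => trivial) (fun s' _ hs => ?_)
    (fun s _ hs => (hQ.hit_eq_trans _ hs).ge) (fun k => ?_) (ENNReal.natCast_ne_top s.orbit)
    (fun s' _ _ => (min_le_right _ _).trans le_add_self) (Set.mem_univ s) |> (le_of_eq ?_).trans
  · simp
  · calc min (s'.orbit : ℝ≥0∞) s.orbit = Q.trans (fun _ => min (s'.orbit : ℝ≥0∞) s.orbit) s' :=
        (trans_const Q _ _).symm
      _ ≤ _ := trans_mono Q fun u => by
        gcongr
        exact orbit_le_step hs u
  · rw [hit_idle]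
    exact min_le_left _ _

/-- Here the weight is the subsolution, and its excess over the hitting mean must be bounded.
Truncation at `M` bounds the repair term, and `orbit_le_hit_id` absorbs the orbit term. -/
theorem weight_le_hit_id (hlam : 0 < Q.lam) (hbeta : ∀ i, 0 ≤ Q.beta i) (hQ : Q.Terminates)
    {M : ℝ≥0∞} (hM : M ≠ ∞) (i : CallType) (n : ℕ) (x : ℝ) :
    n + Q.load M i * ENNReal.ofReal x ≤ Q.hit (fun k => k) (.busy i n x) := by
  have hload : Q.load M i ≠ ∞ := by
    have h1 : Q.meanRepair M i ≤ M := by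
      calc Q.meanRepair M i ≤ ∫⁻ _y, M ∂Q.law (.repair i) :=
            lintegral_mono fun y => min_le_right _ _
        _ = M := by simp
    have := ne_top_of_le_ne_top hM h1
    unfold Model.load
    finiteness
  -- Remaining service time never increases before the server is idle, so `S` is preserved and the
  -- service term is at most its initial value.
  set S : Set State := {s | match s with
    | .idle _ => True
    | .busy j _ x' => j = i ∧ x' ≤ x
    | .failed j _ x' _ => j = i ∧ x' ≤ x} with hS
  have key : ∀ s ∈ S, Q.weight 1 0 0 (Q.load M) M s ≤ Q.hit (fun k => k) s := by
    intro s hs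
    refine hQ.le_of_subsolution (measurable_hit Q _) S (fun s hs hidle u => ?_)
      (fun s _ hs => ?_) (fun s _ hs => (hQ.hit_eq_trans _ hs).ge) (fun k => ?_)
      (C := Q.load M i * ENNReal.ofReal x + ENNReal.ofReal Q.lam * M) (by finiteness)
      (fun s hs hidle => ?_) hs
    · cases s with
      | idle => exact (hidle trivial).elim
      | busy j n x' =>
        obtain ⟨rfl, hx⟩ := hs
        unfold Model.step
        simp only
        split_ifs
        · trivial
        · exact ⟨rfl, (sub_le_self _ ENNReal.toReal_nonneg).trans hx⟩
        · exact ⟨rfl, (sub_le_self _ ENNReal.toReal_nonneg).trans hx⟩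
      | failed j n x' y =>
        unfold Model.step
        simp only
        split_ifs
        · exact hs
        · exact hs
    · cases s with
      | idle => exact (hs trivial).elim
      | busy j n x' =>
        rw [← slope_one, trans_weight_busy hlam hbeta]
        simp [Model.weight]
      | failed j n x' y =>
        refine le_trans ?_ (le_trans_weight_failed hlam (by norm_num) M _ j n x' y)
        simp [Model.weight]
    · rw [hit_idle]
      simp [Model.weight]
    · have horb := orbit_le_hit_id hQ s
      cases s with
      | idle => exact (hidle trivial).elim
      | busy j n x' =>
        obtain ⟨rfl, hx⟩ := hs
        simp only [Model.weight, one_mul, add_zero]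
        refine add_le_add horb (le_trans ?_ le_self_add)
        gcongr
      | failed j n x' y =>
        obtain ⟨rfl, hx⟩ := hs
        simp only [Model.weight, one_mul, add_zero]
        rw [add_assoc]
        refine add_le_add horb ?_
        gcongr
        exact min_le_right _ _
  have := key (.busy i n x) ⟨rfl, le_rfl⟩
  simpa [Model.weight] using this

/-- The mean number of calls in orbit at the end of a service. -/
theorem hit_id_busy (hlam : 0 < Q.lam) (hbeta : ∀ i, 0 ≤ Q.beta i) (hQ : Q.Terminates)
    (i : CallType) (n : ℕ) (x : ℝ) :
    Q.hit (fun k => k) (.busy i n x) = n + Q.load ∞ i * ENNReal.ofReal x := by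
  refine le_antisymm ?_ ?_
  · simpa [Model.weight] using hit_id_le hlam hbeta hQ (.busy i n x)
  -- Monotone convergence as the truncation level of the repair times tends to infinity.
  · have hsup : Q.meanRepair ∞ i = ⨆ M : ℕ, Q.meanRepair M i := by
      unfold Model.meanRepair
      rw [← lintegral_iSup]
      · refine lintegral_congr fun y => ?_
        rw [← inf_iSup_eq, ENNReal.iSup_natCast]
      · exact fun M => by fun_prop
      · intro M N hMN y
        exact min_le_min le_rfl (by exact_mod_cast hMN)
    have : n + Q.load ∞ i * ENNReal.ofReal x =
        ⨆ M : ℕ, (n + Q.load M i * ENNReal.ofReal x) := by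
      unfold Model.load
      rw [hsup, ENNReal.mul_iSup, ENNReal.add_iSup, ENNReal.mul_iSup, ENNReal.iSup_mul,
        ENNReal.add_iSup]
    rw [this]
    exact iSup_le fun M => weight_le_hit_id hlam hbeta hQ (ENNReal.natCast_ne_top M) i n x

end RetrialQueue

/-! ### Positivity, skip-freeness and drift of the embedded kernel -/

namespace RetrialQueue

variable {Q : Model}

/-- With positive probability the service ends before any arrival or failure. -/
theorem hit_point_busy_ne_zero (hlam : 0 < Q.lam) (hbeta : ∀ i, 0 ≤ Q.beta i) (hQ : Q.Terminates)
    (i : CallType) (n : ℕ) (x : ℝ) : Q.hit (pointIndicator n) (.busy i n x) ≠ 0 := by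
  rw [hQ.hit_eq_trans _ id]
  -- The maximum with 0 keeps the draws positive, so that a clock of rate 0 shows infinity.
  refine trans_ne_zero (measurable_hit Q _) (t := fun r => match r with
    | .arrival => Set.Ioi (max 0 (Q.lam * x))
    | .failure => Set.Ioi (max 0 (Q.beta i * x))
    | _ => Set.univ) (fun r => ?_) (fun u hu => ?_)
  · cases r with
    | arrival => exact expMeasure_Ioi_ne_zero _
    | failure => exact expMeasure_Ioi_ne_zero _
    | _ => simp
  · have ha : max 0 (Q.lam * x) < u .arrival := hu .arrival
    have hf : max 0 (Q.beta i * x) < u .failure := hu .failure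
    rw [max_lt_iff] at ha hf
    have hstep : Q.step u (.busy i n x) = .idle n :=
      if_pos ⟨le_clock hlam.le ha.1 ha.2.le, le_clock (hbeta i) hf.1 hf.2.le⟩
    rw [hstep, hit_idle]
    simp [pointIndicator]

theorem hit_succ_busy_ne_zero (hlam : 0 < Q.lam) (hbeta : ∀ i, 0 ≤ Q.beta i) (hQ : Q.Terminates)
    (i : CallType) (n : ℕ) {x : ℝ} (hx : 0 < x) :
    Q.hit (pointIndicator (n + 1)) (.busy i n x) ≠ 0 := by
  rw [hQ.hit_eq_trans _ id]
  refine trans_ne_zero (measurable_hit Q _) (t := fun r => match r with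
    | .arrival => Set.Iio (Q.lam * x)
    | .failure => Set.Ioi (max 0 (Q.beta i * x))
    | _ => Set.univ) (fun r => ?_) (fun u hu => ?_)
  · cases r with
    | arrival => exact expMeasure_Iio_ne_zero (by positivity)
    | failure => exact expMeasure_Ioi_ne_zero _
    | _ => simp
  · have ha : clock Q.lam (u .arrival) < ENNReal.ofReal x := clock_lt hx hlam (hu .arrival)
    have hf : max 0 (Q.beta i * x) < u .failure := hu .failure
    rw [max_lt_iff] at hf
    have hstep : Q.step u (.busy i n x) =
        .busy i (n + 1) (x - (clock Q.lam (u .arrival)).toReal) :=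
      (if_neg fun h => not_lt.2 h.1 ha).trans
        (if_pos (ha.le.trans (le_clock (hbeta i) hf.1 hf.2.le)))
    rw [hstep]
    exact hit_point_busy_ne_zero hlam hbeta hQ i (n + 1) _

theorem law_service_Ioi (hservice : ∀ i, PositiveWithFiniteMean (Q.service i)) (i : CallType) :
    Q.law (.service i) (Set.Ioi 0) ≠ 0 := by
  have h : Set.Ioi (0 : ℝ) ∈ ae (Q.law (.service i)) := (hservice i).1
  rw [(mem_ae_iff_prob_eq_one measurableSet_Ioi).1 h]
  exact one_ne_zero

/-- A transition of the embedded chain that starts with an incoming call. -/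
theorem kernel_ne_zero_of_inbound (hlam : 0 < Q.lam) (halpha : 0 < Q.alpha) (hnu : 0 < Q.nu)
    (hservice : ∀ i, PositiveWithFiniteMean (Q.service i)) (k j : ℕ)
    (h : ∀ x, 0 < x → Q.hit (pointIndicator j) (.busy .inbound k x) ≠ 0) : Q.kernel k j ≠ 0 := by
  -- The arrival clock rings before time 1 and its two competitors do not; for `k = 0` the retrial
  -- clock never rings.
  refine trans_ne_zero (measurable_hit Q _) (t := fun r => match r with
    | .arrival => Set.Iio (Q.lam * 1)
    | .retrial => Set.Ioi (max 0 (k * Q.nu * 1))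
    | .outgoing => Set.Ioi (max 0 (Q.alpha * 1))
    | .service .inbound => Set.Ioi 0
    | _ => Set.univ) (fun r => ?_) (fun u hu => ?_)
  · rcases r with _ | _ | _ | _ | i | i
    · exact expMeasure_Iio_ne_zero (by positivity)
    · exact expMeasure_Ioi_ne_zero _
    · exact expMeasure_Ioi_ne_zero _
    · simp
    · cases i
      · exact law_service_Ioi hservice _
      · simp
    · simp
  · have ha := clock_lt one_pos hlam (hu .arrival)
    have hr : max 0 (k * Q.nu * 1) < u .retrial := hu .retrial
    have ho : max 0 (Q.alpha * 1) < u .outgoing := hu .outgoing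
    have hs : 0 < u (.service .inbound) := hu (.service .inbound)
    rw [max_lt_iff] at hr ho
    have hstep : Q.step u (.idle k) = .busy .inbound k (u (.service .inbound)) :=
      if_pos ⟨ha.le.trans (le_clock (by positivity) hr.1 hr.2.le),
        ha.le.trans (le_clock halpha.le ho.1 ho.2.le)⟩
    rw [hstep]
    exact h _ hs

theorem kernel_self_ne_zero (hlam : 0 < Q.lam) (halpha : 0 < Q.alpha) (hnu : 0 < Q.nu)
    (hbeta : ∀ i, 0 ≤ Q.beta i) (hservice : ∀ i, PositiveWithFiniteMean (Q.service i))
    (hQ : Q.Terminates) (k : ℕ) : Q.kernel k k ≠ 0 :=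
  kernel_ne_zero_of_inbound hlam halpha hnu hservice k k fun x _ =>
    hit_point_busy_ne_zero hlam hbeta hQ _ k x

theorem kernel_up_ne_zero (hlam : 0 < Q.lam) (halpha : 0 < Q.alpha) (hnu : 0 < Q.nu)
    (hbeta : ∀ i, 0 ≤ Q.beta i) (hservice : ∀ i, PositiveWithFiniteMean (Q.service i))
    (hQ : Q.Terminates) (k : ℕ) : Q.kernel k (k + 1) ≠ 0 :=
  kernel_ne_zero_of_inbound hlam halpha hnu hservice k (k + 1) fun _ hx =>
    hit_succ_busy_ne_zero hlam hbeta hQ _ k hx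

theorem kernel_down_ne_zero (hlam : 0 < Q.lam) (halpha : 0 < Q.alpha) (hnu : 0 < Q.nu)
    (hbeta : ∀ i, 0 ≤ Q.beta i) (hQ : Q.Terminates) (k : ℕ) : Q.kernel (k + 1) k ≠ 0 := by
  have hq : 0 < ((k + 1 : ℕ) : ℝ) * Q.nu := by positivity
  refine trans_ne_zero (measurable_hit Q _) (t := fun r => match r with
    | .arrival => Set.Ioi (max 0 (Q.lam * 1))
    | .retrial => Set.Iio (((k + 1 : ℕ) : ℝ) * Q.nu * 1)
    | .outgoing => Set.Ioi (max 0 (Q.alpha * 1))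
    | _ => Set.univ) (fun r => ?_) (fun u hu => ?_)
  · cases r with
    | arrival => exact expMeasure_Ioi_ne_zero _
    | retrial => exact expMeasure_Iio_ne_zero (by positivity)
    | outgoing => exact expMeasure_Ioi_ne_zero _
    | _ => simp
  · have hr := clock_lt one_pos hq (hu .retrial)
    have ha : max 0 (Q.lam * 1) < u .arrival := hu .arrival
    have ho : max 0 (Q.alpha * 1) < u .outgoing := hu .outgoing
    rw [max_lt_iff] at ha ho
    have hstep : Q.step u (.idle (k + 1)) = .busy .inbound k (u (.service .inbound)) :=
      (if_neg fun h => not_lt.2 ((le_clock hlam.le ha.1 ha.2.le).trans h.1) hr).trans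
        (if_pos (hr.le.trans (le_clock halpha.le ho.1 ho.2.le)))
    rw [hstep]
    exact hit_point_busy_ne_zero hlam hbeta hQ _ k _

/-- The orbit cannot shrink during a service, so the indicator of orbit size at most `j` is a
supersolution, and it vanishes at `s`. -/
theorem hit_point_eq_zero_of_lt (hQ : Q.Terminates) {j : ℕ} {s : State} (h : j < s.orbit) :
    Q.hit (pointIndicator j) s = 0 := by
  set F : State → ℝ≥0∞ := fun s => if s.orbit ≤ j then 1 else 0 with hF
  have hFm : Measurable F := measurable_from_nat.comp
    (measurable_orbit : Measurable State.orbit) (g := fun n => if n ≤ j then (1 : ℝ≥0∞) else 0)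
  have hle : Q.hit (pointIndicator j) s ≤ F s := by
    refine hQ.le_of_subsolution hFm Set.univ (fun _ _ _ _ => trivial)
      (fun s _ hs => (hQ.hit_eq_trans _ hs).le) (fun s _ hs => ?_) (fun k => ?_)
      ENNReal.one_ne_top (fun s _ _ => ?_) (Set.mem_univ s)
    · calc Q.trans F s ≤ Q.trans (fun _ => F s) s := trans_mono Q fun u => by
            have := orbit_le_step (Q := Q) hs u
            simp only [hF]
            split_ifs
            · exact le_rfl
            · omega
            · exact zero_le
            · exact le_rfl
        _ = F s := trans_const Q _ _
    · rw [hit_idle]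
      by_cases hk : k = j
      · simp [hF, hk, pointIndicator, State.orbit]
      · simp [pointIndicator, hk]
    · refine le_trans ?_ le_add_self
      refine (hit_mono Q (h := fun _ => 1) (fun k => ?_) s).trans (hit_const Q _ s).le
      exact Set.indicator_le_self' (fun _ _ => zero_le) k
  simp only [hF, not_le.2 h, if_false] at hle
  exact le_antisymm hle bot_le

/-- Only the transition out of the idle state can lower the orbit, and by at most one. -/
theorem kernel_eq_zero_of_lt (hQ : Q.Terminates) (k j : ℕ) (h : j + 1 < k) : Q.kernel k j = 0 := by
  unfold Model.kernel Model.trans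
  have : ∀ u, Q.hit (pointIndicator j) (Q.step u (.idle k)) = 0 := by
    intro u
    refine hit_point_eq_zero_of_lt hQ ?_
    unfold Model.step
    simp only
    split_ifs <;> simp only [State.orbit] <;> omega
  simp [this]

/-- The draws for which the next service after the orbit size `k` is that of an outgoing call. -/
def Model.outgoingFirst (Q : Model) (k : ℕ) : Set (Source → ℝ) :=
  {u | ¬ (clock Q.lam (u .arrival) ≤ clock (k * Q.nu) (u .retrial) ∧
      clock Q.lam (u .arrival) ≤ clock Q.alpha (u .outgoing)) ∧
    ¬ clock (k * Q.nu) (u .retrial) ≤ clock Q.alpha (u .outgoing)}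

/-- The draws for which the next service after the orbit size `k` is that of a call in orbit. -/
def Model.retrialFirst (Q : Model) (k : ℕ) : Set (Source → ℝ) :=
  {u | clock (k * Q.nu) (u .retrial) < clock Q.lam (u .arrival) ∧
    clock (k * Q.nu) (u .retrial) ≤ clock Q.alpha (u .outgoing)}

theorem measurableSet_outgoingFirst (k : ℕ) : MeasurableSet (Q.outgoingFirst k) :=
  (((measurableSet_le (measurable_clock_eval _ _) (measurable_clock_eval _ _)).inter
    (measurableSet_le (measurable_clock_eval _ _) (measurable_clock_eval _ _))).compl).inter
    (measurableSet_le (measurable_clock_eval _ _) (measurable_clock_eval _ _)).compl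

theorem measurableSet_retrialFirst (k : ℕ) : MeasurableSet (Q.retrialFirst k) :=
  (measurableSet_lt (measurable_clock_eval _ _) (measurable_clock_eval _ _)).inter
    (measurableSet_le (measurable_clock_eval _ _) (measurable_clock_eval _ _))

theorem retrialFirst_subset (k : ℕ) : Q.retrialFirst k ⊆ (Q.outgoingFirst k)ᶜ :=
  fun _ hu h => h.2 hu.2

/-- The mean number of calls that arrive during a service with its interruptions. -/
noncomputable def Model.meanArrivals (Q : Model) (i : CallType) : ℝ≥0∞ :=
  Q.load ∞ i * ∫⁻ x, ENNReal.ofReal x ∂Q.law (.service i)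

/-- The departure of a retrying call is added on the left, to avoid subtraction in `ℝ≥0∞`. For `k ≠
0` the natural number `k - 1` in the step is a true difference. -/
theorem hit_id_step_idle (hlam : 0 < Q.lam) (hbeta : ∀ i, 0 ≤ Q.beta i) (hQ : Q.Terminates)
    {k : ℕ} (hk : k ≠ 0) (u : Source → ℝ) :
    Q.hit (fun k => k) (Q.step u (.idle k)) + (Q.retrialFirst k).indicator 1 u =
      k + ((Q.outgoingFirst k)ᶜ.indicator
          (fun u => Q.load ∞ .inbound * ENNReal.ofReal (u (.service .inbound))) u +
        (Q.outgoingFirst k).indicator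
          (fun u => Q.load ∞ .outbound * ENNReal.ofReal (u (.service .outbound))) u) := by
  obtain ⟨k, rfl⟩ := Nat.exists_eq_succ_of_ne_zero hk
  set a := clock Q.lam (u .arrival) with ha
  set r := clock ((k.succ : ℕ) * Q.nu) (u .retrial) with hr
  set o := clock Q.alpha (u .outgoing) with ho
  change Q.hit (fun k => k) (if a ≤ r ∧ a ≤ o then .busy .inbound k.succ (u (.service .inbound))
      else if r ≤ o then .busy .inbound (k.succ - 1) (u (.service .inbound))
      else .busy .outbound k.succ (u (.service .outbound))) + _ = _
  by_cases h1 : a ≤ r ∧ a ≤ o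
  · have hnr : u ∉ Q.retrialFirst k.succ := fun h => not_lt.2 h1.1 h.1
    have hno : u ∉ Q.outgoingFirst k.succ := fun h => h.1 h1
    rw [if_pos h1, Set.indicator_of_notMem hnr, Set.indicator_of_mem hno,
      Set.indicator_of_notMem hno, hit_id_busy hlam hbeta hQ, add_zero, add_zero]
  · rw [if_neg h1]
    by_cases h2 : r ≤ o
    · have hra : r < a := by
        by_contra h
        exact h1 ⟨not_lt.1 h, (not_lt.1 h).trans h2⟩
      have hyr : u ∈ Q.retrialFirst k.succ := ⟨hra, h2⟩
      have hno : u ∉ Q.outgoingFirst k.succ := fun h => h.2 h2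
      rw [if_pos h2, Set.indicator_of_mem hyr, Set.indicator_of_mem hno,
        Set.indicator_of_notMem hno, hit_id_busy hlam hbeta hQ]
      push_cast
      simp only [Pi.one_apply]
      ring
    · have hnr : u ∉ Q.retrialFirst k.succ := fun h => h2 h.2
      have hyo : u ∈ Q.outgoingFirst k.succ := ⟨h1, h2⟩
      have hyo' : u ∉ (Q.outgoingFirst k.succ)ᶜ := fun h => h hyo
      rw [if_neg h2, Set.indicator_of_notMem hnr, Set.indicator_of_mem hyo,
        Set.indicator_of_notMem hyo', hit_id_busy hlam hbeta hQ, add_zero, zero_add]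

/-- The mean of the embedded chain after one step. -/
theorem tsum_kernel_mul_id (hlam : 0 < Q.lam) (hbeta : ∀ i, 0 ≤ Q.beta i) (hQ : Q.Terminates)
    {k : ℕ} (hk : k ≠ 0) :
    ∑' j, Q.kernel k j * (j : ℝ≥0∞) + Q.draw (Q.retrialFirst k) =
      k + (Q.draw (Q.outgoingFirst k)ᶜ * Q.meanArrivals .inbound +
        Q.draw (Q.outgoingFirst k) * Q.meanArrivals .outbound) := by
  have hO := measurableSet_outgoingFirst (Q := Q) k
  have hR := measurableSet_retrialFirst (Q := Q) k
  have hind : ∀ (i : CallType) u e,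
      Function.update u (.service i) e ∈ Q.outgoingFirst k ↔ u ∈ Q.outgoingFirst k := by
    intro i u e; simp [Model.outgoingFirst]
  have hg : ∀ i, Measurable fun x : ℝ => Q.load ∞ i * ENNReal.ofReal x := fun i => by fun_prop
  have hmean : ∀ i, ∫⁻ x, Q.load ∞ i * ENNReal.ofReal x ∂Q.law (.service i) = Q.meanArrivals i :=
    fun i => lintegral_const_mul _ (by fun_prop)
  have hm : Measurable fun u : Source → ℝ =>
      Q.load ∞ .inbound * ENNReal.ofReal (u (.service .inbound)) :=
    (hg .inbound).comp (measurable_pi_apply _)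
  rw [tsum_kernel_mul, Model.trans, ← lintegral_indicator_one hR,
    ← lintegral_add_right _ (measurable_one.indicator hR),
    lintegral_congr (hit_id_step_idle hlam hbeta hQ hk), lintegral_add_left measurable_const,
    lintegral_add_left (hm.indicator hO.compl),
    lintegral_draw_indicator Q _ hO.compl (fun u e => not_congr (hind .inbound u e)) (hg .inbound),
    lintegral_draw_indicator Q _ hO (hind .outbound) (hg .outbound), hmean, hmean]
  simp

/-- For fixed positive arrival and outgoing draws, the retrial clock of rate kν beats both once k is
large. The complements decrease in k, so continuity from above applies. -/
theorem tendsto_draw_retrialFirst_compl (hlam : 0 < Q.lam) (halpha : 0 < Q.alpha)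
    (hnu : 0 < Q.nu) : Tendsto (fun k => Q.draw (Q.retrialFirst k)ᶜ) atTop (nhds 0) := by
  have hanti : Antitone fun k => (Q.retrialFirst k)ᶜ := by
    intro k l hkl
    refine Set.compl_subset_compl.2 fun u hu => ?_
    have : clock (l * Q.nu) (u .retrial) ≤ clock (k * Q.nu) (u .retrial) := by
      unfold clock
      gcongr
    exact ⟨this.trans_lt hu.1, this.trans hu.2⟩
  have hnull : Q.draw (⋂ k, (Q.retrialFirst k)ᶜ) = 0 := by
    have h1 : ∀ᵐ u ∂Q.draw, 0 < u .arrival :=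
      ae_draw_eval Q .arrival (p := fun e => 0 < e) ae_expMeasure_pos
    have h2 : ∀ᵐ u ∂Q.draw, 0 < u .outgoing :=
      ae_draw_eval Q .outgoing (p := fun e => 0 < e) ae_expMeasure_pos
    have h3 : ∀ᵐ u ∂Q.draw, u ∉ ⋂ k, (Q.retrialFirst k)ᶜ := by
      filter_upwards [h1, h2] with u ha ho hu
      set δ := min (u .arrival / Q.lam) (u .outgoing / Q.alpha) with hδ
      have hδ0 : 0 < δ := lt_min (by positivity) (by positivity)
      obtain ⟨k, hk⟩ := exists_nat_gt (max 0 (u .retrial / (δ * Q.nu)))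
      rw [max_lt_iff] at hk
      have hq : 0 < (k : ℝ) * Q.nu := mul_pos hk.1 hnu
      have hr : clock (k * Q.nu) (u .retrial) < ENNReal.ofReal δ := by
        refine clock_lt hδ0 hq ?_
        have := (div_lt_iff₀ (mul_pos hδ0 hnu)).1 hk.2
        linarith
      refine Set.mem_iInter.1 hu k ⟨hr.trans_le ?_, hr.le.trans ?_⟩
      · rw [clock_eq_ofReal hlam]
        exact ENNReal.ofReal_le_ofReal (min_le_left _ _)
      · rw [clock_eq_ofReal halpha]
        exact ENNReal.ofReal_le_ofReal (min_le_right _ _)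
    exact measure_eq_zero_iff_ae_notMem.2 h3
  rw [← hnull]
  exact tendsto_measure_iInter_atTop
    (fun k => (measurableSet_retrialFirst k).compl.nullMeasurableSet) hanti ⟨0, measure_ne_top _ _⟩

theorem tsum_kernel_mul_id_lt_top (hlam : 0 < Q.lam) (hbeta : ∀ i, 0 ≤ Q.beta i)
    (hQ : Q.Terminates) (hfin : ∀ i, Q.meanArrivals i ≠ ∞) (k : ℕ) :
    ∑' j, Q.kernel k j * (j : ℝ≥0∞) < ∞ := by
  have hle : ∀ u, Q.hit (fun k => k) (Q.step u (.idle k)) ≤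
      k + (Q.load ∞ .inbound * ENNReal.ofReal (u (.service .inbound)) +
        Q.load ∞ .outbound * ENNReal.ofReal (u (.service .outbound))) := by
    intro u
    unfold Model.step
    simp only
    split_ifs
    · rw [hit_id_busy hlam hbeta hQ]
      gcongr
      exact le_self_add
    · rw [hit_id_busy hlam hbeta hQ]
      gcongr
      · exact Nat.sub_le k 1
      · exact le_self_add
    · rw [hit_id_busy hlam hbeta hQ]
      gcongr
      exact le_add_self
  have hg : ∀ i, Measurable fun x : ℝ => Q.load ∞ i * ENNReal.ofReal x := fun i => by fun_prop
  have hmean : ∀ i, ∫⁻ u, Q.load ∞ i * ENNReal.ofReal (u (.service i)) ∂Q.draw =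
      Q.meanArrivals i := fun i => by
    rw [lintegral_draw_eval Q (.service i) (hg i)]
    exact lintegral_const_mul _ (by fun_prop)
  rw [tsum_kernel_mul]
  refine (lintegral_mono hle).trans_lt ?_
  have hm : Measurable fun u : Source → ℝ =>
      Q.load ∞ .inbound * ENNReal.ofReal (u (.service .inbound)) :=
    (hg .inbound).comp (measurable_pi_apply _)
  rw [lintegral_add_left measurable_const, lintegral_add_left hm, hmean, hmean]
  simp only [lintegral_const, measure_univ, mul_one]
  have h1 := hfin .inbound
  have h2 := hfin .outbound
  finiteness

/-- A retrial that comes first starts a service of type 1, whose at least one mean arrival makes up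
for the departure from orbit. This works at every `k`, without a limit. -/
theorem le_tsum_kernel_mul_id (hlam : 0 < Q.lam) (hbeta : ∀ i, 0 ≤ Q.beta i) (hQ : Q.Terminates)
    (hload : 1 ≤ Q.meanArrivals .inbound) (k : ℕ) :
    (k : ℝ≥0∞) ≤ ∑' j, Q.kernel k j * (j : ℝ≥0∞) := by
  rcases eq_or_ne k 0 with rfl | hk
  · simp
  · refine (ENNReal.add_le_add_iff_right (measure_ne_top Q.draw (Q.retrialFirst k))).1 ?_
    rw [tsum_kernel_mul_id hlam hbeta hQ hk]
    gcongr
    calc Q.draw (Q.retrialFirst k) ≤ Q.draw (Q.outgoingFirst k)ᶜ * 1 := by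
          rw [mul_one]
          exact measure_mono (retrialFirst_subset k)
      _ ≤ Q.draw (Q.outgoingFirst k)ᶜ * Q.meanArrivals .inbound := by gcongr
      _ ≤ _ := le_self_add

theorem exists_negative_drift (hlam : 0 < Q.lam) (halpha : 0 < Q.alpha) (hnu : 0 < Q.nu)
    (hbeta : ∀ i, 0 ≤ Q.beta i) (hQ : Q.Terminates) (hfin : ∀ i, Q.meanArrivals i ≠ ∞)
    (hload : Q.meanArrivals .inbound < 1) :
    ∃ ε : ℝ≥0∞, ε ≠ 0 ∧ ε ≠ ∞ ∧ ∃ N, ∀ k : ℕ, N ≤ k →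
      ∑' j, Q.kernel k j * (j : ℝ≥0∞) + ε ≤ k := by
  set ρ := Q.meanArrivals .inbound with hρ
  -- Half of the gap is the final drift; the other half absorbs the error at finite `k`.
  set ε := (1 - ρ) / 2 with hε
  have hε0 : 0 < ε := ENNReal.half_pos (tsub_pos_of_lt hload).ne'
  have hεtop : ε ≠ ∞ := by
    refine ENNReal.div_ne_top ?_ (by norm_num)
    exact ne_top_of_le_ne_top ENNReal.one_ne_top tsub_le_self
  have hsplit : ρ + (ε + ε) = 1 := by
    rw [hε, ENNReal.add_halves]
    exact add_tsub_cancel_of_le hload.le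
  -- When no retrial comes first, the error consists of the missing departure (1) and at most the
  -- arrivals of an outgoing service.
  have hlim := ENNReal.Tendsto.const_mul (a := 1 + Q.meanArrivals .outbound)
    (tendsto_draw_retrialFirst_compl hlam halpha hnu)
    (.inr (ENNReal.add_ne_top.2 ⟨ENNReal.one_ne_top, hfin .outbound⟩))
  rw [mul_zero] at hlim
  obtain ⟨N, hN⟩ := eventually_atTop.1 (hlim.eventually_le_const hε0)
  -- Starting at `N + 1` ensures `k ≠ 0`, as the mean formula requires.
  refine ⟨ε, hε0.ne', hεtop, N + 1, fun k hk => ?_⟩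
  have hN := hN k (by omega)
  have hmean := tsum_kernel_mul_id hlam hbeta hQ (k := k) (by omega)
  set m := ∑' j, Q.kernel k j * (j : ℝ≥0∞)
  have hone : Q.draw (Q.retrialFirst k) + Q.draw (Q.retrialFirst k)ᶜ = 1 := by
    rw [measure_add_measure_compl (measurableSet_retrialFirst k), measure_univ]
  have hout : Q.draw (Q.outgoingFirst k) ≤ Q.draw (Q.retrialFirst k)ᶜ :=
    measure_mono (Set.subset_compl_comm.1 (retrialFirst_subset k))
  -- The finite quantity ρ + ε is added to both sides and cancelled at the end, in place of a
  -- subtraction in `ℝ≥0∞`.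
  have hfinal : (m + ε) + (ρ + ε) ≤ k + (ρ + ε) := by
    calc (m + ε) + (ρ + ε) = m + (ρ + (ε + ε)) := by ring
      _ = (m + Q.draw (Q.retrialFirst k)) + Q.draw (Q.retrialFirst k)ᶜ := by
        rw [hsplit, ← hone, add_assoc]
      _ ≤ k + (1 * ρ + Q.draw (Q.retrialFirst k)ᶜ * Q.meanArrivals .outbound) +
          Q.draw (Q.retrialFirst k)ᶜ := by
        rw [hmean]
        gcongr
        exact prob_le_one
      _ = k + (ρ + (1 + Q.meanArrivals .outbound) * Q.draw (Q.retrialFirst k)ᶜ) := by ring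
      _ ≤ k + (ρ + ε) := by gcongr
  exact (ENNReal.add_le_add_iff_right
    (ENNReal.add_ne_top.2 ⟨hload.ne_top, hεtop⟩)).1 hfinal

theorem lintegral_ofReal_eq_mean {ρ : ProbabilityMeasure ℝ} (h : PositiveWithFiniteMean ρ) :
    ∫⁻ x, ENNReal.ofReal x ∂(ρ : Measure ℝ) = ENNReal.ofReal (mean ρ) :=
  (ofReal_integral_eq_lintegral_ofReal h.2 (h.1.mono fun _ hx => hx.le)).symm

theorem mean_nonneg {ρ : ProbabilityMeasure ℝ} (h : PositiveWithFiniteMean ρ) : 0 ≤ mean ρ :=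
  integral_nonneg_of_ae (h.1.mono fun _ hx => hx.le)

theorem meanRepair_eq (hrepair : ∀ i, PositiveWithFiniteMean (Q.repair i)) (i : CallType) :
    Q.meanRepair ∞ i = ENNReal.ofReal (mean (Q.repair i)) := by
  rw [← lintegral_ofReal_eq_mean (hrepair i)]
  simp only [Model.meanRepair, min_top_right]
  rfl

theorem meanArrivals_eq (hlam : 0 < Q.lam) (hbeta : ∀ i, 0 ≤ Q.beta i)
    (hservice : ∀ i, PositiveWithFiniteMean (Q.service i))
    (hrepair : ∀ i, PositiveWithFiniteMean (Q.repair i)) (i : CallType) :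
    Q.meanArrivals i = ENNReal.ofReal
      (Q.lam * mean (Q.service i) * (1 + Q.beta i * mean (Q.repair i))) := by
  have hS := mean_nonneg (hservice i)
  have hR := mean_nonneg (hrepair i)
  have hb := hbeta i
  have hs : ∫⁻ x, ENNReal.ofReal x ∂Q.law (.service i) = ENNReal.ofReal (mean (Q.service i)) :=
    lintegral_ofReal_eq_mean (hservice i)
  rw [Model.meanArrivals, Model.load, meanRepair_eq hrepair, hs, ← ENNReal.ofReal_mul hb,
    ← ENNReal.ofReal_one, ← ENNReal.ofReal_add zero_le_one (by positivity),
    ← ENNReal.ofReal_mul hlam.le, ← ENNReal.ofReal_mul (by positivity)]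
  congr 1
  ring

end RetrialQueue

/-! ### The stability condition -/

theorem theorem1 (Q : RetrialQueue.Model)
    (hlam : 0 < Q.lam) (halpha : 0 < Q.alpha) (hnu : 0 < Q.nu) (hbeta : ∀ i, 0 ≤ Q.beta i)
    (hservice : ∀ i, RetrialQueue.PositiveWithFiniteMean (Q.service i))
    (hrepair : ∀ i, RetrialQueue.PositiveWithFiniteMean (Q.repair i)) :
    (∀ k : ℕ, ∀ᵐ w ∂Q.prob, ∃ᶠ m in atTop, (Q.state k w m).IsIdle) ∧
    DiscreteChain.IsMarkov Q.prob Q.embedded ∧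
    DiscreteChain.IsIrreducible Q.prob Q.embedded ∧
    DiscreteChain.IsAperiodic Q.prob Q.embedded ∧
    (DiscreteChain.IsErgodic Q.prob Q.embedded ↔
      Q.lam * RetrialQueue.mean (Q.service .inbound) *
        (1 + Q.beta .inbound * RetrialQueue.mean (Q.repair .inbound)) < 1) := by
  open RetrialQueue DiscreteChain in
  have hQ : Q.Terminates := terminates hlam hbeta fun i => by
    rw [meanRepair_eq hrepair]
    exact ENNReal.ofReal_ne_top
  have harr := meanArrivals_eq hlam hbeta hservice hrepair
  have hcyl := hQ.measure_cylinder
  have hup := kernel_up_ne_zero hlam halpha hnu hbeta hservice hQ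
  have hdown := kernel_down_ne_zero hlam halpha hnu hbeta hQ
  have hirr : IsIrreducible Q.prob Q.embedded := isIrreducible_of_step hcyl hup hdown
  have haper : IsAperiodic Q.prob Q.embedded :=
    isAperiodic_of_stay hcyl (kernel_self_ne_zero hlam halpha hnu hbeta hservice hQ)
  have hreturn := lintegral_returnTime measurable_embedded hcyl
  refine ⟨fun k => ?_, ⟨measurable_embedded, Q.kernel, tsum_kernel Q, hcyl⟩, hirr, haper, ?_⟩
  · simp only [state_eq_path]
    exact hQ.ae_frequently_isIdle (.idle k)
  constructor
  · intro herg
    by_contra hge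
    have hone : 1 ≤ Q.meanArrivals .inbound := by
      rw [harr]
      exact ENNReal.one_le_ofReal.2 (not_lt.1 hge)
    have htop := tsum_avoid_zero_eq_top (tsum_kernel Q) (kernel_eq_zero_of_lt hQ) (hup 0)
      (le_tsum_kernel_mul_id hlam hbeta hQ hone)
    have := herg.2.2 0
    rw [hreturn, htop] at this
    exact this.ne rfl
  · intro hlt
    refine ⟨hirr, haper, fun i => ?_⟩
    have hone : Q.meanArrivals .inbound < 1 := by
      rw [harr]
      exact ENNReal.ofReal_lt_one.2 hlt
    have hfin : ∀ i, Q.meanArrivals i ≠ ∞ := fun i => by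
      rw [harr]
      exact ENNReal.ofReal_ne_top
    obtain ⟨ε, hε, hε', N, hN⟩ := exists_negative_drift hlam halpha hnu hbeta hQ hfin hone
    obtain ⟨V, hV⟩ := exists_isLyapunov_singleton (tsum_kernel Q) (kernel_eq_zero_of_lt hQ) hup
      hdown (tsum_kernel_mul_id_lt_top hlam hbeta hQ hfin) hε hε' hN i
    rw [hreturn]
    exact tsum_avoid_lt_top (hV.1 i) hV.2
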